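/- Let $n\ge 2$ and identify $\mathbb{C}^n$ with $\mathbb{R}^{2n}$ via $(\xi_{k1}+i\xi_{k2})_{k}\mapsto(\xi_{11},\xi_{12},\dots,\xi_{n1},\xi_{n2})$. Let $\mathcal{K}_n$ be the set of convex bodies $K\subset\mathbb{R}^{2n}$ (compact, convex, with the origin in the interior) that are contained in the open unit ball and are $R_\theta$-invariant, i.e. the Minkowski functional $\|x\|_K=\min\{a\ge 0: x\in aK\}$ is invariant under the simultaneous rotation by $\theta$ of all pairs of coordinates $(x_{k1},x_{k2})$, for every $\theta\in[0,2\pi]$. For $\xi\in S^{2n-1}$ let $H_\xi=\{z\in\mathbb{C}^n:\sum_k z_k\overline{\xi_k}=0\}$, a real subspace of $\mathbb{R}^{2n}$ of dimension $2n-2$, and let $$\mathrm{HVol}_{2n}(K)=8^n\int_K\frac{dx}{(1-|x|^2)^{n+1}},\qquad \mathrm{HVol}_{2n-2}(K\cap H_\xi)=8^{n-1}\int_{K\cap H_\xi}\frac{dx}{(1-|x|^2)^{n}}$$ be the volumes in the ball model of complex hyperbolic space $\mathbb{H}_{\mathbb{C}}^n$. The following are equivalent. 1. (Affirmative answer to the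 Busemann-Petty problem in $\mathbb{H}_{\mathbb{C}}^n$.) For all $K,L\in\mathcal{K}_n$, if $\mathrm{HVol}_{2n-2}(K\cap H_\xi)\le \mathrm{HVol}_{2n-2}(L\cap H_\xi)$ for every $\xi\in S^{2n-1}$, then $\mathrm{HVol}_{2n}(K)\le\mathrm{HVol}_{2n}(L)$. 2. For every $K\in\mathcal{K}_n$ the function $$f_K(x)=\frac{\|x\|_K^{-2}}{1-\left(\frac{|x|}{\|x\|_K}\right)^2}$$ defines a (tempered) distribution $\varphi\mapsto\int_{\mathbb{R}^{2n}} f_K\varphi\,dx$ that is positive definite, i.e. $\langle f_K,\ \varphi*\overline{\varphi(-\,\cdot\,)}\rangle\ge 0$ for every Schwartz function $\varphi:\mathbb{R}^{2n}\to\mathbb{C}$. -/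

import Mathlib

open MeasureTheory
open scoped SchwartzMap ComplexConjugate

noncomputable section

namespace ComplexHyperbolicBP

/-- `ℝ²ⁿ` with its Euclidean structure. The coordinate `x (k, 0)` is the real part and `x (k, 1)`
the imaginary part of the `k`-th coordinate of the corresponding point of `ℂⁿ`. -/
abbrev RSpace (n : ℕ) : Type := EuclideanSpace ℝ (Fin n × Fin 2)

/-- The identification of `ℝ²ⁿ` with `ℂⁿ`. -/
def toComplex {n : ℕ} (x : RSpace n) (k : Fin n) : ℂ := ⟨x (k, 0), x (k, 1)⟩

/-- Counterclockwise rotation by `θ` applied to each pair of coordinates `(x (k, 0), x (k, 1))`. -/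
def rot {n : ℕ} (θ : ℝ) (x : RSpace n) : RSpace n :=
  WithLp.toLp 2 fun p =>
    if p.2 = 0 then Real.cos θ * x (p.1, 0) - Real.sin θ * x (p.1, 1)
    else Real.sin θ * x (p.1, 0) + Real.cos θ * x (p.1, 1)

/-- The vector `ξ_⊥ = (-ξ₁₂, ξ₁₁, …, -ξₙ₂, ξₙ₁)`, i.e. `i ξ` in complex notation. -/
def perp {n : ℕ} (ξ : RSpace n) : RSpace n :=
  WithLp.toLp 2 fun p => if p.2 = 0 then -ξ (p.1, 1) else ξ (p.1, 0)

/-- The complex hyperplane `H_ξ` as a real subspace of `ℝ²ⁿ`: the orthogonal complement of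
`ξ` and `ξ_⊥`. -/
def hyperplane {n : ℕ} (ξ : RSpace n) : Submodule ℝ (RSpace n) :=
  (Submodule.span ℝ {ξ, perp ξ})ᗮ

/-- In complex notation, `H_ξ` is given by the equation `∑ z_k * conj ξ_k = 0`. -/
theorem mem_hyperplane_iff {n : ℕ} (ξ x : RSpace n) :
    x ∈ hyperplane ξ ↔ ∑ k, toComplex x k * conj (toComplex ξ k) = 0 := by
  have h : x ∈ hyperplane ξ ↔ inner ℝ ξ x = 0 ∧ inner ℝ (perp ξ) x = 0 := by
    rw [hyperplane, Submodule.mem_orthogonal]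
    constructor
    · intro h
      exact ⟨h _ (Submodule.subset_span (by simp)), h _ (Submodule.subset_span (by simp))⟩
    · rintro ⟨h1, h2⟩ u hu
      obtain ⟨a, b, rfl⟩ := Submodule.mem_span_pair.1 hu
      simp [inner_add_left, inner_smul_left, h1, h2]
  rw [h, Complex.ext_iff]
  simp only [PiLp.inner_apply, Fintype.sum_prod_type, Fin.sum_univ_two, perp, toComplex,
    Complex.re_sum, Complex.im_sum]
  simp [mul_comm, sub_eq_add_neg]

/-- A coordinatewise rotation is multiplication by `exp (i θ)` in every coordinate. -/
theorem toComplex_rot {n : ℕ} (θ : ℝ) (x : RSpace n) (k : Fin n) :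
    toComplex (rot θ x) k = Complex.exp (θ * Complex.I) * toComplex x k := by
  apply Complex.ext <;>
    simp [toComplex, rot, Complex.exp_ofReal_mul_I_re, Complex.exp_ofReal_mul_I_im, add_comm]

/-- The Minkowski functional of `K` is invariant under all coordinatewise rotations. -/
def IsRotInvariant {n : ℕ} (K : Set (RSpace n)) : Prop :=
  ∀ θ ∈ Set.Icc (0 : ℝ) (2 * Real.pi), ∀ ξ : RSpace n, gauge K (rot θ ξ) = gauge K ξ

/-- The bodies of the problem: rotation-invariant convex bodies with the origin in the interior,
contained in the (open) unit ball, which is the ball model of complex hyperbolic space. -/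
structure IsAdmissible {n : ℕ} (K : ConvexBody (RSpace n)) : Prop where
  zero_mem_interior : (0 : RSpace n) ∈ interior (K : Set (RSpace n))
  rotInvariant : IsRotInvariant (K : Set (RSpace n))
  subset_ball : (K : Set (RSpace n)) ⊆ Metric.ball 0 1

section Volume

variable (V : Type*) [NormedAddCommGroup V] [InnerProductSpace ℝ V] [FiniteDimensional ℝ V]
  [MeasurableSpace V] [BorelSpace V]

/-- The volume measure `8 ^ m * (1 - |x|²) ^ (-(m + 1)) dx` of the ball model of complex hyperbolic
`m`-space, on the open unit ball of a Euclidean space `V` of real dimension `2 * m`; `dx` is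
Lebesgue measure of `V`. In polar coordinates it is
`8 ^ m * r ^ (2 * m - 1) * (1 - r²) ^ (-(m + 1)) dr dσ`. -/
def hypMeasure (m : ℕ) : Measure V :=
  ((volume : Measure V).restrict (Metric.ball 0 1)).withDensity
    fun x => ENNReal.ofReal (8 ^ m / (1 - ‖x‖ ^ 2) ^ (m + 1))

end Volume

/-- `HVol_{2n}(K)`. -/
def hvol {n : ℕ} (K : Set (RSpace n)) : ENNReal := hypMeasure (RSpace n) n K

/-- `HVol_{2n-2}(K ∩ H_ξ)`, computed in the `(2n-2)`-dimensional Euclidean space `H_ξ`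
(for `ξ ≠ 0`). -/
def hvolSection {n : ℕ} (K : Set (RSpace n)) (ξ : RSpace n) : ENNReal :=
  hypMeasure (hyperplane ξ) (n - 1) {x : hyperplane ξ | (x : RSpace n) ∈ K}

/-- The Busemann-Petty problem in complex hyperbolic `n`-space has an affirmative answer. -/
def BusemannPettyAffirmative (n : ℕ) : Prop :=
  ∀ K L : ConvexBody (RSpace n), IsAdmissible K → IsAdmissible L →
    (∀ ξ : RSpace n, ‖ξ‖ = 1 →
      hvolSection (K : Set (RSpace n)) ξ ≤ hvolSection (L : Set (RSpace n)) ξ) →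
    hvol (K : Set (RSpace n)) ≤ hvol (L : Set (RSpace n))

section Distribution

variable {V : Type*} [NormedAddCommGroup V] [InnerProductSpace ℝ V]

/-- The test function `x ↦ conj (φ (-x))`. -/
def conjReflect (φ : 𝓢(V, ℂ)) : 𝓢(V, ℂ) :=
  SchwartzMap.postcompCLM (𝕜 := ℝ) (Complex.conjCLE : ℂ →L[ℝ] ℂ)
    (SchwartzMap.compCLMOfContinuousLinearEquiv ℝ (ContinuousLinearEquiv.neg ℝ (M := V)) φ)

theorem conjReflect_apply (φ : 𝓢(V, ℂ)) (x : V) : conjReflect φ x = conj (φ (-x)) := by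
  simp [conjReflect]

variable [FiniteDimensional ℝ V] [MeasurableSpace V] [BorelSpace V]

/-- The test function `φ ∗ conj φ(-·)`. -/
def autoConv (φ : 𝓢(V, ℂ)) : 𝓢(V, ℂ) :=
  SchwartzMap.convolution (ContinuousLinearMap.mul ℂ ℂ) φ (conjReflect φ)

theorem autoConv_apply (φ : 𝓢(V, ℂ)) (x : V) :
    autoConv φ x = ∫ y, φ y * conj (φ (-(x - y))) := by
  simp [autoConv, SchwartzMap.convolution_apply, MeasureTheory.convolution, conjReflect_apply]

/-- A distribution `T` is positive definite if `⟨T, φ ∗ conj φ(-·)⟩` is a non-negative real number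
for every test function `φ`. -/
def IsPositiveDefinite (T : 𝓢'(V, ℂ)) : Prop :=
  ∀ φ : 𝓢(V, ℂ), 0 ≤ (T (autoConv φ)).re ∧ (T (autoConv φ)).im = 0

/-- The distribution `T` is the one given by integration against the function `f`. -/
def Represents (f : V → ℝ) (T : 𝓢'(V, ℂ)) : Prop :=
  ∀ φ : 𝓢(V, ℂ), Integrable (fun x => (f x : ℂ) * φ x) ∧ T φ = ∫ x, (f x : ℂ) * φ x

/-- The function `f` defines a tempered distribution, and this distribution is positive definite. -/
def IsPositiveDefiniteDistribution (f : V → ℝ) : Prop :=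
  ∃ T : 𝓢'(V, ℂ), Represents f T ∧ IsPositiveDefinite T

end Distribution

/-- The function `‖x‖_K⁻² / (1 - (|x| / ‖x‖_K)²)`. -/
def bpFunction {n : ℕ} (K : Set (RSpace n)) (x : RSpace n) : ℝ :=
  (gauge K x ^ 2)⁻¹ / (1 - (‖x‖ / gauge K x) ^ 2)

end ComplexHyperbolicBP

end

/-!
Write `f_K` for `bpFunction K` and `θ` for a point of the unit sphere. In polar coordinates the
hyperbolic volume of `K` is a multiple of `∫ f_K(θ) ^ n dθ` and that of the section by `H_ξ` is a
multiple of the integral of `f_K ^ (n - 1)` over the unit sphere of `H_ξ`. Both properties hold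
for `n = 2` and fail for `n ≥ 3`.

For `n = 2` the hyperplane `H_ξ` is a complex line, on whose unit circle `f_K` is constant, so
comparing the sections amounts to comparing `f_K` and `f_L` pointwise. Moreover `f_K` is a
superposition of Lebesgue measures on complex lines, each of which is positive definite.

For `n = m + 1 ≥ 3` put `s = |x_k|²` for a fixed complex coordinate `k`. Since the mean of `m s - 1`
over the unit sphere of every `H_ξ` is non-positive, bodies with `f_K ^ m = f_L ^ m + δ (m s - 1)`
and `δ > 0` satisfy the hypothesis of the Busemann-Petty problem. If `∫ f_L (m s - 1) > 0`, then
`∫ f_L ^ n < ∫ f_K ^ m f_L`, so by Young's inequality `∫ f_L ^ n < ∫ f_K ^ n` and the conclusion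
fails. Such bodies exist when `δ` is small and `L` is small and sufficiently elongated
along the coordinate `k`. The inequality `∫ f_L (m s - 1) > 0` also contradicts positive
definiteness of `f_L`, tested on the Hermite functions `⟨x, e⟩ exp(-|x|²)`.
-/

noncomputable section

namespace ComplexHyperbolicBP

section Polar

variable {V : Type*} [NormedAddCommGroup V] [NormedSpace ℝ V]

theorem homeomorphUnitSphereProd_smul (x : ({0}ᶜ : Set V)) :
    ((homeomorphUnitSphereProd V x).2 : ℝ) • ((homeomorphUnitSphereProd V x).1 : V) = x := by
  have hx : ‖(x : V)‖ ≠ 0 := norm_ne_zero_iff.2 x.2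
  simp [smul_smul, mul_inv_cancel₀ hx]

theorem lintegral_volumeIoiPow (k : ℕ) {g : ℝ → ENNReal} (hg : Measurable g) :
    ∫⁻ r : Set.Ioi (0 : ℝ), g r ∂(Measure.volumeIoiPow k) =
      ∫⁻ r in Set.Ioi (0 : ℝ), ENNReal.ofReal (r ^ k) * g r := by
  rw [Measure.volumeIoiPow, lintegral_withDensity_eq_lintegral_mul _ (by fun_prop) (by fun_prop)]
  exact lintegral_subtype_comap measurableSet_Ioi
    (fun r : ℝ => ENNReal.ofReal (r ^ k) * g r)

theorem integral_volumeIoiPow {E : Type*} [NormedAddCommGroup E] [NormedSpace ℝ E]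
    (k : ℕ) (g : ℝ → E) :
    ∫ r : Set.Ioi (0 : ℝ), g r ∂(Measure.volumeIoiPow k) =
      ∫ r in Set.Ioi (0 : ℝ), r ^ k • g r := by
  simp only [Measure.volumeIoiPow, ENNReal.ofReal]
  rw [integral_withDensity_eq_integral_smul ((measurable_subtype_coe.pow_const _).real_toNNReal),
    integral_subtype_comap measurableSet_Ioi fun r ↦ Real.toNNReal (r ^ k) • g r]
  refine setIntegral_congr_fun measurableSet_Ioi fun r hr => ?_
  rw [NNReal.smul_def, Real.coe_toNNReal _ (pow_nonneg (Set.mem_Ioi.1 hr).le _)]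

variable [FiniteDimensional ℝ V] [MeasurableSpace V] [BorelSpace V]
  (μ : Measure V) [μ.IsAddHaarMeasure]

theorem lintegral_eq_lintegral_toSphere [Nontrivial V] {f : V → ENNReal} (hf : Measurable f) :
    ∫⁻ x, f x ∂μ = ∫⁻ θ : Metric.sphere (0 : V) 1, (∫⁻ r in Set.Ioi (0 : ℝ),
      ENNReal.ofReal (r ^ (Module.finrank ℝ V - 1)) * f (r • (θ : V))) ∂μ.toSphere := by
  have hpolar : Measurable fun p : Metric.sphere (0 : V) 1 × Set.Ioi (0 : ℝ) =>
      f ((p.2 : ℝ) • (p.1 : V)) := by fun_prop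
  calc ∫⁻ x, f x ∂μ = ∫⁻ x : ({0}ᶜ : Set V), f x ∂(μ.comap Subtype.val) := by
        rw [lintegral_subtype_comap (measurableSet_singleton _).compl, restrict_compl_singleton]
    _ = ∫⁻ p : Metric.sphere (0 : V) 1 × Set.Ioi (0 : ℝ), f ((p.2 : ℝ) • (p.1 : V))
          ∂(μ.toSphere.prod (Measure.volumeIoiPow (Module.finrank ℝ V - 1))) := by
        simpa only [homeomorphUnitSphereProd_smul] using
          μ.measurePreserving_homeomorphUnitSphereProd.lintegral_comp hpolar
    _ = _ := by
        rw [lintegral_prod _ hpolar.aemeasurable]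
        exact lintegral_congr fun θ =>
          lintegral_volumeIoiPow _ (g := fun r => f (r • (θ : V))) (by fun_prop)

theorem integral_eq_integral_toSphere_prod [Nontrivial V] {E : Type*} [NormedAddCommGroup E]
    [NormedSpace ℝ E] (f : V → E) :
    ∫ x, f x ∂μ = ∫ p : Metric.sphere (0 : V) 1 × Set.Ioi (0 : ℝ), f ((p.2 : ℝ) • (p.1 : V))
      ∂(μ.toSphere.prod (Measure.volumeIoiPow (Module.finrank ℝ V - 1))) := by
  calc ∫ x, f x ∂μ = ∫ x : ({0}ᶜ : Set V), f x ∂(μ.comap Subtype.val) := by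
        rw [integral_subtype_comap (measurableSet_singleton _).compl, restrict_compl_singleton]
    _ = _ := by
        simpa only [homeomorphUnitSphereProd_smul] using
          μ.measurePreserving_homeomorphUnitSphereProd.integral_comp
            (Homeomorph.measurableEmbedding _)
            fun p : Metric.sphere (0 : V) 1 × Set.Ioi (0 : ℝ) => f ((p.2 : ℝ) • (p.1 : V))

variable {μ}

theorem integrable_toSphere_prod {E : Type*} [NormedAddCommGroup E] {f : V → E}
    (hf : Integrable f μ) :
    Integrable (fun p : Metric.sphere (0 : V) 1 × Set.Ioi (0 : ℝ) => f ((p.2 : ℝ) • (p.1 : V)))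
      (μ.toSphere.prod (Measure.volumeIoiPow (Module.finrank ℝ V - 1))) := by
  rw [← μ.measurePreserving_homeomorphUnitSphereProd.integrable_comp_emb
    (Homeomorph.measurableEmbedding _)]
  refine ((integrableOn_iff_comap_subtypeVal (measurableSet_singleton _).compl).1
    hf.integrableOn).congr (.of_forall fun x => ?_)
  simp only [Function.comp_apply, homeomorphUnitSphereProd_smul]

theorem integral_eq_integral_toSphere [Nontrivial V] {E : Type*} [NormedAddCommGroup E]
    [NormedSpace ℝ E] {f : V → E} (hf : Integrable f μ) :
    ∫ x, f x ∂μ = ∫ θ : Metric.sphere (0 : V) 1,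
      (∫ r in Set.Ioi (0 : ℝ), r ^ (Module.finrank ℝ V - 1) • f (r • (θ : V))) ∂μ.toSphere := by
  rw [integral_eq_integral_toSphere_prod, integral_prod _ (integrable_toSphere_prod hf)]
  exact integral_congr_ae (.of_forall fun θ => integral_volumeIoiPow _ fun r => f (r • (θ : V)))

end Polar

section SphereMeasure

theorem integrable_of_continuous {X E : Type*} [TopologicalSpace X] [CompactSpace X]
    [MeasurableSpace X] [BorelSpace X] {μ : Measure X} [IsFiniteMeasure μ] [NormedAddCommGroup E]
    {g : X → E} (hg : Continuous g) : Integrable g μ :=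
  hg.integrable_of_hasCompactSupport (HasCompactSupport.of_compactSpace g)

variable {V : Type*} [NormedAddCommGroup V] [InnerProductSpace ℝ V]

/-- The linear isometry `T` restricted to the unit sphere. -/
def sphereMap (T : V ≃ₗᵢ[ℝ] V) (θ : Metric.sphere (0 : V) 1) : Metric.sphere (0 : V) 1 :=
  ⟨T θ, by simp⟩

theorem continuous_sphereMap (T : V ≃ₗᵢ[ℝ] V) : Continuous (sphereMap T) := by
  unfold sphereMap
  fun_prop

theorem injective_sphereMap (T : V ≃ₗᵢ[ℝ] V) : Function.Injective (sphereMap T) :=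
  fun _ _ h => Subtype.ext (T.injective (congrArg Subtype.val h))

open scoped Pointwise in
theorem smul_image_preimage_sphereMap (T : V ≃ₗᵢ[ℝ] V) (I : Set ℝ)
    (s : Set (Metric.sphere (0 : V) 1)) :
    I • (Subtype.val '' (sphereMap T ⁻¹' s)) = T ⁻¹' (I • (Subtype.val '' s)) := by
  ext x
  simp only [Set.mem_smul, Set.mem_image, Set.mem_preimage]
  constructor
  · rintro ⟨r, hr, _, ⟨θ, hθ, rfl⟩, rfl⟩
    exact ⟨r, hr, T θ, ⟨sphereMap T θ, hθ, rfl⟩, by simp⟩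
  · rintro ⟨r, hr, _, ⟨θ, hθ, rfl⟩, h⟩
    have hinv : sphereMap T (sphereMap T.symm θ) = θ := by
      ext
      simp [sphereMap]
    exact ⟨r, hr, T.symm θ, ⟨sphereMap T.symm θ, by rwa [hinv], rfl⟩,
      T.injective (by simpa using h)⟩

variable [FiniteDimensional ℝ V] [MeasurableSpace V] [BorelSpace V]

/-- The surface measure of the unit sphere of a Euclidean space. -/
abbrev sphereMeasure (V : Type*) [NormedAddCommGroup V] [InnerProductSpace ℝ V]
    [FiniteDimensional ℝ V] [MeasurableSpace V] [BorelSpace V] :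
    Measure (Metric.sphere (0 : V) 1) :=
  (volume : Measure V).toSphere

theorem sphereMeasure_real_univ_pos [Nontrivial V] : 0 < (sphereMeasure V).real Set.univ := by
  have : NeZero (sphereMeasure V) := ⟨Measure.toSphere_ne_zero _⟩
  exact measureReal_univ_pos

theorem measurePreserving_sphereMap (T : V ≃ₗᵢ[ℝ] V) :
    MeasurePreserving (sphereMap T) (sphereMeasure V) (sphereMeasure V) := by
  have hmeas : Measurable (sphereMap T) := (continuous_sphereMap T).measurable
  refine ⟨hmeas, Measure.ext fun s hs => ?_⟩
  rw [Measure.map_apply hmeas hs, Measure.toSphere_apply' _ (hmeas hs),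
    Measure.toSphere_apply' _ hs, smul_image_preimage_sphereMap]
  congr 1
  exact T.measurePreserving.measure_preimage_equiv (f := T.toMeasurableEquiv) _

theorem integral_sphereMap {E : Type*} [NormedAddCommGroup E] [NormedSpace ℝ E]
    (T : V ≃ₗᵢ[ℝ] V) (g : Metric.sphere (0 : V) 1 → E) :
    ∫ θ, g (sphereMap T θ) ∂sphereMeasure V = ∫ θ, g θ ∂sphereMeasure V :=
  (measurePreserving_sphereMap T).integral_comp
    ((continuous_sphereMap T).measurableEmbedding (injective_sphereMap T)) g

theorem integral_sphere_inner_sq_congr {a b : V} (hab : ‖a‖ = ‖b‖) :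
    ∫ θ, inner ℝ (θ : V) a ^ 2 ∂sphereMeasure V = ∫ θ, inner ℝ (θ : V) b ^ 2 ∂sphereMeasure V := by
  let T : V ≃ₗᵢ[ℝ] V := (ℝ ∙ (a - b))ᗮ.reflection
  have hT : T a = b := Submodule.reflection_sub hab
  rw [← integral_sphereMap T fun θ => inner ℝ (θ : V) b ^ 2]
  refine integral_congr_ae (.of_forall fun θ => ?_)
  change inner ℝ (θ : V) a ^ 2 = inner ℝ (T θ) b ^ 2
  rw [← hT, T.inner_map_map]

theorem sum_integral_sphere_inner_sq {ι : Type*} [Fintype ι] (b : OrthonormalBasis ι ℝ V) :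
    ∑ i, ∫ θ, inner ℝ (θ : V) (b i) ^ 2 ∂sphereMeasure V = (sphereMeasure V).real Set.univ := by
  have hsum : ∀ θ : Metric.sphere (0 : V) 1, ∑ i, inner ℝ (θ : V) (b i) ^ 2 = 1 := fun θ => by
    simpa using b.sum_sq_norm_inner_left (θ : V)
  rw [← integral_finsetSum _ fun i _ => integrable_of_continuous (by fun_prop)]
  simp [hsum]

theorem finrank_mul_integral_sphere_inner_sq (e : V) :
    Module.finrank ℝ V * ∫ θ, inner ℝ (θ : V) e ^ 2 ∂sphereMeasure V =
      ‖e‖ ^ 2 * (sphereMeasure V).real Set.univ := by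
  let b := stdOrthonormalBasis ℝ V
  have hscale : ∀ i, ∫ θ, inner ℝ (θ : V) e ^ 2 ∂sphereMeasure V =
      ‖e‖ ^ 2 * ∫ θ, inner ℝ (θ : V) (b i) ^ 2 ∂sphereMeasure V := fun i => by
    rw [integral_sphere_inner_sq_congr (b := ‖e‖ • b i) (by simp [norm_smul]),
      ← integral_const_mul]
    simp only [inner_smul_right, mul_pow]
  rw [← sum_integral_sphere_inner_sq b, Finset.mul_sum, ← Finset.sum_congr rfl fun i _ => hscale i]
  simp

end SphereMeasure

section HyperbolicVolume

/-- The density of `hypMeasure V m` with respect to the polar coordinates `dr dσ`, for `V` of real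
dimension `2 * m`. -/
def hypRadialDensity (m : ℕ) (r : ℝ) : ℝ := r ^ (2 * m - 1) * (8 ^ m / (1 - r ^ 2) ^ (m + 1))

theorem continuousOn_hypRadialDensity (m : ℕ) {b : ℝ} (hb : b < 1) :
    ContinuousOn (hypRadialDensity m) (Set.Icc 0 b) := by
  refine ContinuousOn.mul (by fun_prop) (ContinuousOn.div (by fun_prop) (by fun_prop) ?_)
  intro r hr
  have hr2 : r ^ 2 < 1 := pow_lt_one₀ hr.1 (hr.2.trans_lt hb) two_ne_zero
  exact pow_ne_zero _ (sub_pos.2 hr2).ne'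

theorem hypRadialDensity_nonneg (m : ℕ) {r : ℝ} (hr : r ∈ Set.Icc 0 1) :
    0 ≤ hypRadialDensity m r := by
  have hr2 : 0 ≤ 1 - r ^ 2 := sub_nonneg.2 (pow_le_one₀ hr.1 hr.2)
  exact mul_nonneg (pow_nonneg hr.1 _) (by positivity)

theorem hasDerivAt_hypRadialDensity {m : ℕ} (hm : 0 < m) {r : ℝ} (hr : r ^ 2 < 1) :
    HasDerivAt (fun r : ℝ => 8 ^ m / (2 * m) * (r ^ 2 / (1 - r ^ 2)) ^ m)
      (hypRadialDensity m r) r := by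
  have hne : (1 : ℝ) - r ^ 2 ≠ 0 := (sub_pos.2 hr).ne'
  have hsq : HasDerivAt (fun r : ℝ => r ^ 2) (2 * r) r := by simpa using hasDerivAt_pow 2 r
  refine (((hsq.fun_div (hsq.const_sub 1) hne).fun_pow m).const_mul _).congr_deriv ?_
  obtain ⟨k, rfl⟩ : ∃ k, m = k + 1 := ⟨m - 1, by omega⟩
  have hk : ((k + 1 : ℕ) : ℝ) ≠ 0 := by positivity
  rw [hypRadialDensity, show 2 * (k + 1) - 1 = 2 * k + 1 by omega]
  simp only [Nat.add_sub_cancel, div_pow]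
  field_simp
  ring

theorem integral_hypRadialDensity {m : ℕ} (hm : 0 < m) {b : ℝ} (hb₀ : 0 ≤ b) (hb₁ : b < 1) :
    ∫ r in (0 : ℝ)..b, hypRadialDensity m r = 8 ^ m / (2 * m) * (b ^ 2 / (1 - b ^ 2)) ^ m := by
  rw [intervalIntegral.integral_eq_sub_of_hasDerivAt
    (f := fun r : ℝ => 8 ^ m / (2 * m) * (r ^ 2 / (1 - r ^ 2)) ^ m)]
  · simp [hm.ne']
  · intro r hr
    rw [Set.uIcc_of_le hb₀] at hr
    exact hasDerivAt_hypRadialDensity hm (pow_lt_one₀ hr.1 (hr.2.trans_lt hb₁) two_ne_zero)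
  · apply ContinuousOn.intervalIntegrable
    rw [Set.uIcc_of_le hb₀]
    exact continuousOn_hypRadialDensity m hb₁

theorem lintegral_hypRadialDensity {m : ℕ} (hm : 0 < m) {b : ℝ} (hb₀ : 0 ≤ b) (hb₁ : b < 1) :
    ∫⁻ r in Set.Ioc 0 b, ENNReal.ofReal (hypRadialDensity m r) =
      ENNReal.ofReal (8 ^ m / (2 * m) * (b ^ 2 / (1 - b ^ 2)) ^ m) := by
  rw [← integral_hypRadialDensity hm hb₀ hb₁, intervalIntegral.integral_of_le hb₀,
    ofReal_integral_eq_lintegral_ofReal]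
  · exact (continuousOn_hypRadialDensity m hb₁).integrableOn_Icc.mono_set Set.Ioc_subset_Icc_self
  · filter_upwards [ae_restrict_mem measurableSet_Ioc] with r hr
    exact hypRadialDensity_nonneg m ⟨hr.1.le, hr.2.trans hb₁.le⟩

theorem lintegral_indicator_hypRadialDensity {m : ℕ} (hm : 0 < m) {a : ℝ} (ha : 1 < a) :
    ∫⁻ r in Set.Ioi (0 : ℝ), ENNReal.ofReal (r ^ (2 * m - 1)) *
      ({r : ℝ | r * a ≤ 1}.indicator
        (fun r => ENNReal.ofReal (8 ^ m / (1 - r ^ 2) ^ (m + 1))) r) =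
      ENNReal.ofReal (8 ^ m / (2 * m) * ((a ^ 2 - 1)⁻¹) ^ m) := by
  have ha₀ : 0 < a := by linarith
  have hset : {r : ℝ | r * a ≤ 1} = Set.Iic a⁻¹ := by
    ext r
    rw [Set.mem_ofPred_eq, Set.mem_Iic, ← one_div, le_div_iff₀ ha₀]
  have hvalue : (a⁻¹) ^ 2 / (1 - (a⁻¹) ^ 2) = (a ^ 2 - 1)⁻¹ := by
    have : a ^ 2 - 1 ≠ 0 := by nlinarith
    field_simp
  calc _ = ∫⁻ r in Set.Ioi (0 : ℝ), (Set.Iic a⁻¹).indicator (fun r =>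
        ENNReal.ofReal (hypRadialDensity m r)) r := by
        rw [hset]
        refine setLIntegral_congr_fun measurableSet_Ioi fun r hr => ?_
        by_cases hra : r ∈ Set.Iic a⁻¹
        · simp only [Set.indicator_of_mem hra, hypRadialDensity,
            ENNReal.ofReal_mul (pow_nonneg (Set.mem_Ioi.1 hr).le _)]
        · simp only [Set.indicator_of_notMem hra, mul_zero]
    _ = ∫⁻ r in Set.Ioc 0 a⁻¹, ENNReal.ofReal (hypRadialDensity m r) := by
        rw [lintegral_indicator measurableSet_Iic, Measure.restrict_restrict measurableSet_Iic,
          Set.inter_comm, Set.Ioi_inter_Iic]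
    _ = _ := by
        rw [lintegral_hypRadialDensity hm (by positivity) (inv_lt_one_of_one_lt₀ ha), hvalue]

section

variable {V : Type*} [NormedAddCommGroup V] [NormedSpace ℝ V] {g : V → ℝ}

theorem norm_lt_of_homogeneous (hom : ∀ r : ℝ, 0 ≤ r → ∀ x, g (r • x) = r * g x)
    (hg : ∀ x, ‖x‖ = 1 → 1 < g x) {x : V} (hx : x ≠ 0) : ‖x‖ < g x := by
  have hpos : 0 < ‖x‖ := norm_pos_iff.2 hx
  calc ‖x‖ < ‖x‖ * g (‖x‖⁻¹ • x) :=
        lt_mul_of_one_lt_right hpos (hg _ (by simp [norm_smul, hpos.ne']))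
    _ = g x := by rw [← hom _ hpos.le, smul_smul, mul_inv_cancel₀ hpos.ne', one_smul]

theorem sublevel_subset_ball (hom : ∀ r : ℝ, 0 ≤ r → ∀ x, g (r • x) = r * g x)
    (hg : ∀ x, ‖x‖ = 1 → 1 < g x) : {x | g x ≤ 1} ⊆ Metric.ball (0 : V) 1 := by
  intro x hx
  rw [mem_ball_zero_iff]
  rcases eq_or_ne x 0 with rfl | hx₀
  · simp
  · exact (norm_lt_of_homogeneous hom hg hx₀).trans_le hx

end

variable {V : Type*} [NormedAddCommGroup V] [InnerProductSpace ℝ V] [FiniteDimensional ℝ V]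
  [MeasurableSpace V] [BorelSpace V]

theorem hypMeasure_eq_lintegral_sphere {m : ℕ} (hm : 0 < m) (hV : Module.finrank ℝ V = 2 * m)
    {g : V → ℝ} (hg : Continuous g) (hom : ∀ r : ℝ, 0 ≤ r → ∀ x, g (r • x) = r * g x)
    (hg₁ : ∀ x, ‖x‖ = 1 → 1 < g x) :
    hypMeasure V m {x | g x ≤ 1} = ∫⁻ θ : Metric.sphere (0 : V) 1,
      ENNReal.ofReal (8 ^ m / (2 * m) * ((g θ ^ 2 - 1)⁻¹) ^ m) ∂sphereMeasure V := by
  have : Nontrivial V := Module.nontrivial_of_finrank_pos (R := ℝ) (by omega)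
  have hmeas : MeasurableSet {x | g x ≤ 1} := (isClosed_le hg continuous_const).measurableSet
  have hdens : Measurable fun x : V => ENNReal.ofReal (8 ^ m / (1 - ‖x‖ ^ 2) ^ (m + 1)) := by
    fun_prop
  rw [hypMeasure, withDensity_apply _ hmeas, Measure.restrict_restrict hmeas,
    Set.inter_eq_left.2 (sublevel_subset_ball hom hg₁), ← lintegral_indicator hmeas,
    lintegral_eq_lintegral_toSphere _ (hdens.indicator hmeas), hV]
  refine lintegral_congr fun θ => ?_
  rw [← lintegral_indicator_hypRadialDensity hm (hg₁ θ (by simp))]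
  refine setLIntegral_congr_fun measurableSet_Ioi fun r (hr : 0 < r) => ?_
  simp [Set.indicator, hom r hr.le, norm_smul, abs_of_pos hr]

theorem hypMeasure_eq_integral_sphere {m : ℕ} (hm : 0 < m) (hV : Module.finrank ℝ V = 2 * m)
    {g : V → ℝ} (hg : Continuous g) (hom : ∀ r : ℝ, 0 ≤ r → ∀ x, g (r • x) = r * g x)
    (hg₁ : ∀ x, ‖x‖ = 1 → 1 < g x) :
    hypMeasure V m {x | g x ≤ 1} = ENNReal.ofReal
      (8 ^ m / (2 * m) * ∫ θ, ((g (θ : V) ^ 2 - 1)⁻¹) ^ m ∂sphereMeasure V) := by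
  have hpos : ∀ θ : Metric.sphere (0 : V) 1, 0 < g (θ : V) ^ 2 - 1 := fun θ =>
    sub_pos.2 (one_lt_pow₀ (hg₁ θ (by simp)) two_ne_zero)
  have hcont : Continuous fun θ : Metric.sphere (0 : V) 1 => ((g (θ : V) ^ 2 - 1)⁻¹) ^ m :=
    (Continuous.inv₀ (by fun_prop) fun θ => (hpos θ).ne').pow m
  rw [hypMeasure_eq_lintegral_sphere hm hV hg hom hg₁, ← integral_const_mul,
    ofReal_integral_eq_lintegral_ofReal ((integrable_of_continuous hcont).const_mul _)]
  refine .of_forall fun θ => ?_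
  have := hpos θ
  dsimp only [Pi.zero_apply]
  positivity

end HyperbolicVolume

section ComplexStructure

variable {n : ℕ}

theorem finrank_RSpace (n : ℕ) : Module.finrank ℝ (RSpace n) = 2 * n := by
  simp [mul_comm]

theorem norm_sq_eq (x : RSpace n) : ‖x‖ ^ 2 = ∑ k, (x (k, 0) ^ 2 + x (k, 1) ^ 2) := by
  rw [EuclideanSpace.norm_sq_eq, Fintype.sum_prod_type]
  simp [Fin.sum_univ_two]

theorem norm_perp (ξ : RSpace n) : ‖perp ξ‖ = ‖ξ‖ := by
  rw [← sq_eq_sq₀ (norm_nonneg _) (norm_nonneg _), norm_sq_eq, norm_sq_eq]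
  simp [perp, add_comm]

theorem inner_perp (ξ : RSpace n) : inner ℝ ξ (perp ξ) = 0 := by
  simp only [PiLp.inner_apply, Fintype.sum_prod_type, Fin.sum_univ_two, perp]
  simp [mul_comm]

theorem orthonormal_perp {ξ : RSpace n} (hξ : ‖ξ‖ = 1) : Orthonormal ℝ ![ξ, perp ξ] := by
  rw [orthonormal_iff_ite]
  have hsymm : inner ℝ (perp ξ) ξ = 0 := by rw [real_inner_comm, inner_perp]
  intro i j
  fin_cases i <;> fin_cases j <;> simp [norm_perp, hξ, inner_perp, hsymm]

theorem finrank_span_perp {ξ : RSpace n} (hξ : ‖ξ‖ = 1) :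
    Module.finrank ℝ (Submodule.span ℝ {ξ, perp ξ}) = 2 := by
  rw [← Matrix.range_cons_cons_empty ξ (perp ξ) ![],
    finrank_span_eq_card (orthonormal_perp hξ).linearIndependent, Fintype.card_fin]

theorem finrank_hyperplane {ξ : RSpace n} (hξ : ‖ξ‖ = 1) :
    Module.finrank ℝ (hyperplane ξ) = 2 * (n - 1) := by
  have hadd := Submodule.finrank_add_finrank_orthogonal (Submodule.span ℝ {ξ, perp ξ})
  rw [finrank_span_perp hξ, finrank_RSpace] at hadd
  unfold hyperplane
  omega

theorem nontrivial_hyperplane (hn : 2 ≤ n) {ξ : RSpace n} (hξ : ‖ξ‖ = 1) :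
    Nontrivial (hyperplane ξ) :=
  Module.nontrivial_of_finrank_pos (R := ℝ) (by rw [finrank_hyperplane hξ]; omega)

end ComplexStructure

section AdmissibleBody

variable {n : ℕ} {K : ConvexBody (RSpace n)}

theorem bpFunction_smul (K : Set (RSpace n)) {r : ℝ} (hr : 0 < r) (x : RSpace n) :
    bpFunction K (r • x) = (r ^ 2)⁻¹ * bpFunction K x := by
  unfold bpFunction
  rw [gauge_smul_of_nonneg hr.le, norm_smul, Real.norm_of_nonneg hr.le, smul_eq_mul,
    mul_div_mul_left _ _ hr.ne', mul_pow, mul_inv, mul_div_assoc]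

namespace IsAdmissible

theorem mem_nhds (hK : IsAdmissible K) : (K : Set (RSpace n)) ∈ nhds (0 : RSpace n) :=
  mem_interior_iff_mem_nhds.1 hK.zero_mem_interior

theorem continuous_gauge (hK : IsAdmissible K) : Continuous (gauge (K : Set (RSpace n))) :=
  _root_.continuous_gauge K.convex hK.mem_nhds

theorem gauge_le_one_iff (hK : IsAdmissible K) (x : RSpace n) :
    gauge (K : Set (RSpace n)) x ≤ 1 ↔ x ∈ (K : Set (RSpace n)) := by
  rw [gauge_le_one_iff_mem_closure K.convex hK.mem_nhds, K.isClosed.closure_eq]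

theorem norm_lt_gauge (hK : IsAdmissible K) {x : RSpace n} (hx : x ≠ 0) :
    ‖x‖ < gauge (K : Set (RSpace n)) x := by
  have hpos : 0 < gauge (K : Set (RSpace n)) x :=
    (gauge_pos (absorbent_nhds_zero hK.mem_nhds)
      ((NormedSpace.isVonNBounded_iff ℝ).2 K.isBounded)).2 hx
  have hmem : (gauge (K : Set (RSpace n)) x)⁻¹ • x ∈ (K : Set (RSpace n)) := by
    rw [← hK.gauge_le_one_iff, gauge_smul_of_nonneg (inv_nonneg.2 hpos.le), smul_eq_mul,
      inv_mul_cancel₀ hpos.ne']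
  simpa [norm_smul, abs_of_pos hpos, inv_mul_lt_iff₀ hpos] using hK.subset_ball hmem

theorem one_lt_gauge (hK : IsAdmissible K) {x : RSpace n} (hx : ‖x‖ = 1) :
    1 < gauge (K : Set (RSpace n)) x :=
  hx ▸ hK.norm_lt_gauge (norm_ne_zero_iff.1 (hx ▸ one_ne_zero))

theorem bpFunction_eq (hK : IsAdmissible K) {x : RSpace n} (hx : x ≠ 0) :
    bpFunction (K : Set (RSpace n)) x = (gauge (K : Set (RSpace n)) x ^ 2 - ‖x‖ ^ 2)⁻¹ := by
  have hpos : 0 < gauge (K : Set (RSpace n)) x := (norm_nonneg x).trans_lt (hK.norm_lt_gauge hx)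
  rw [bpFunction, ← one_div, div_div, ← one_div]
  congr 1
  field_simp

theorem bpFunction_of_norm_eq_one (hK : IsAdmissible K) {x : RSpace n} (hx : ‖x‖ = 1) :
    bpFunction (K : Set (RSpace n)) x = (gauge (K : Set (RSpace n)) x ^ 2 - 1)⁻¹ := by
  rw [hK.bpFunction_eq (norm_ne_zero_iff.1 (hx ▸ one_ne_zero)), hx, one_pow]

theorem bpFunction_pos (hK : IsAdmissible K) {x : RSpace n} (hx : x ≠ 0) :
    0 < bpFunction (K : Set (RSpace n)) x := by
  rw [hK.bpFunction_eq hx, inv_pos, sub_pos]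
  exact pow_lt_pow_left₀ (hK.norm_lt_gauge hx) (norm_nonneg x) two_ne_zero

theorem bpFunction_nonneg (hK : IsAdmissible K) (x : RSpace n) :
    0 ≤ bpFunction (K : Set (RSpace n)) x := by
  rcases eq_or_ne x 0 with rfl | hx
  · simp [bpFunction]
  · exact (hK.bpFunction_pos hx).le

theorem continuousOn_bpFunction (hK : IsAdmissible K) :
    ContinuousOn (bpFunction (K : Set (RSpace n))) {0}ᶜ := by
  have hgauge := hK.continuous_gauge
  refine ContinuousOn.congr (ContinuousOn.inv₀ (by fun_prop) fun x hx => ?_)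
    fun x hx => hK.bpFunction_eq hx
  exact (inv_pos.1 (hK.bpFunction_eq hx ▸ hK.bpFunction_pos hx)).ne'

theorem continuous_bpFunction_sphere (hK : IsAdmissible K) :
    Continuous fun θ : Metric.sphere (0 : RSpace n) 1 => bpFunction (K : Set (RSpace n)) θ :=
  hK.continuousOn_bpFunction.comp_continuous continuous_subtype_val ne_zero_of_mem_unit_sphere

theorem hvol_eq (hn : 0 < n) (hK : IsAdmissible K) :
    hvol (K : Set (RSpace n)) = ENNReal.ofReal (8 ^ n / (2 * n) *
      ∫ θ : Metric.sphere (0 : RSpace n) 1, bpFunction (K : Set (RSpace n)) θ ^ n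
        ∂sphereMeasure (RSpace n)) := by
  have hpolar := hypMeasure_eq_integral_sphere hn (finrank_RSpace n) hK.continuous_gauge
    (fun r hr x => gauge_smul_of_nonneg hr x) fun x hx => hK.one_lt_gauge hx
  simp only [hK.gauge_le_one_iff, Set.ofPred_mem_eq] at hpolar
  simpa only [hvol, hK.bpFunction_of_norm_eq_one (norm_eq_of_mem_sphere _)] using hpolar

theorem hvolSection_eq (hn : 2 ≤ n) (hK : IsAdmissible K) {ξ : RSpace n} (hξ : ‖ξ‖ = 1) :
    hvolSection (K : Set (RSpace n)) ξ = ENNReal.ofReal (8 ^ (n - 1) / (2 * (n - 1 : ℕ)) *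
      ∫ θ : Metric.sphere (0 : hyperplane ξ) 1,
        bpFunction (K : Set (RSpace n)) ((θ : hyperplane ξ) : RSpace n) ^ (n - 1)
        ∂sphereMeasure (hyperplane ξ)) := by
  have hpolar := hypMeasure_eq_integral_sphere (V := hyperplane ξ) (m := n - 1) (by omega)
    (finrank_hyperplane hξ) (hK.continuous_gauge.comp continuous_subtype_val)
    (fun r hr x => gauge_smul_of_nonneg hr (x : RSpace n)) fun x hx => hK.one_lt_gauge hx
  simp only [Function.comp_apply, hK.gauge_le_one_iff] at hpolar
  have hunit (θ : Metric.sphere (0 : hyperplane ξ) 1) : ‖((θ : hyperplane ξ) : RSpace n)‖ = 1 :=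
    norm_eq_of_mem_sphere θ
  simpa only [hvolSection, hK.bpFunction_of_norm_eq_one (hunit _)] using hpolar

end IsAdmissible

end AdmissibleBody

section Convexity

theorem convexOn_of_forall_exists_convexOn_le {E : Type*} [AddCommGroup E] [Module ℝ E] {f : E → ℝ}
    (hf : ∀ z, ∃ q : E → ℝ, ConvexOn ℝ Set.univ q ∧ q z = f z ∧ ∀ x, q x ≤ f x) :
    ConvexOn ℝ Set.univ f := by
  refine ⟨convex_univ, fun x _ y _ α β hα hβ hαβ => ?_⟩
  obtain ⟨q, hq, hqz, hqf⟩ := hf (α • x + β • y)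
  calc f (α • x + β • y) = q (α • x + β • y) := hqz.symm
    _ ≤ α • q x + β • q y := hq.2 trivial trivial hα hβ hαβ
    _ ≤ α • f x + β • f y := by gcongr <;> apply hqf

variable {V W : Type*} [NormedAddCommGroup V] [InnerProductSpace ℝ V]
  [NormedAddCommGroup W] [InnerProductSpace ℝ W]

theorem norm_sq_convex_combination (x y : V) {α β : ℝ} (h : α + β = 1) :
    ‖α • x + β • y‖ ^ 2 = α * ‖x‖ ^ 2 + β * ‖y‖ ^ 2 - α * β * ‖x - y‖ ^ 2 := by
  obtain rfl : β = 1 - α := by linarith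
  rw [norm_add_sq_real, norm_sub_sq_real, real_inner_smul_left, real_inner_smul_right, norm_smul,
    norm_smul, mul_pow, mul_pow, Real.norm_eq_abs, Real.norm_eq_abs, sq_abs, sq_abs]
  ring

theorem convexOn_norm_sq_add_norm_sq_map {P : V →ₗ[ℝ] W} {A B : ℝ}
    (hnonneg : ∀ x, 0 ≤ A * ‖x‖ ^ 2 + B * ‖P x‖ ^ 2) :
    ConvexOn ℝ Set.univ fun x => A * ‖x‖ ^ 2 + B * ‖P x‖ ^ 2 := by
  refine ⟨convex_univ, fun x _ y _ α β hα hβ hαβ => ?_⟩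
  have hdiff : 0 ≤ α * β * (A * ‖x - y‖ ^ 2 + B * ‖P x - P y‖ ^ 2) :=
    mul_nonneg (mul_nonneg hα hβ) (map_sub P x y ▸ hnonneg (x - y))
  simp only [map_add, map_smul, smul_eq_mul, norm_sq_convex_combination _ _ hαβ]
  linarith

theorem add_mul_sub_le_of_convexOn {S : Set ℝ} {f : ℝ → ℝ} (hf : ConvexOn ℝ S f)
    {a f' : ℝ} (ha : a ∈ S) (hf' : HasDerivAt f f' a) {s : ℝ} (hs : s ∈ S) :
    f a + f' * (s - a) ≤ f s := by
  rcases lt_trichotomy a s with has | rfl | hsa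
  · have hslope := hf.le_slope_of_hasDerivAt ha hs has hf'
    rw [slope_def_field, le_div_iff₀ (sub_pos.2 has)] at hslope
    linarith
  · simp
  · have hslope := hf.slope_le_of_hasDerivAt hs ha hsa hf'
    rw [slope_def_field, div_le_iff₀ (sub_pos.2 hsa)] at hslope
    linarith

end Convexity

section AxialForm

variable {V W : Type*} [NormedAddCommGroup V] [InnerProductSpace ℝ V]
  [NormedAddCommGroup W] [InnerProductSpace ℝ W] {P : V →ₗ[ℝ] W}

/-- The squared ratio of the norm of the component `P x` to the norm of `x`, with value `0` at
`x = 0`. -/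
def axialRatio (P : V →ₗ[ℝ] W) (x : V) : ℝ := ‖P x‖ ^ 2 / ‖x‖ ^ 2

/-- The function `|x|² (1 + ε p(s))`, where `s` is the axial ratio of `x`. It is homogeneous of
degree two and its sublevel set is the body whose radial function in a direction `x` is
`(1 + ε p(s)) ^ (-1/2)`. -/
def axialForm (P : V →ₗ[ℝ] W) (ε : ℝ) (p : ℝ → ℝ) (x : V) : ℝ :=
  ‖x‖ ^ 2 * (1 + ε * p (axialRatio P x))

theorem axialRatio_mem (hP : ∀ x, ‖P x‖ ≤ ‖x‖) (x : V) : axialRatio P x ∈ Set.Icc (0 : ℝ) 1 :=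
  ⟨by unfold axialRatio; positivity,
    div_le_one_of_le₀ (pow_le_pow_left₀ (norm_nonneg _) (hP x) 2) (by positivity)⟩

theorem norm_sq_mul_axialRatio (P : V →ₗ[ℝ] W) (x : V) :
    ‖x‖ ^ 2 * axialRatio P x = ‖P x‖ ^ 2 := by
  rcases eq_or_ne x 0 with rfl | hx
  · simp
  · exact mul_div_cancel₀ _ (pow_ne_zero 2 (norm_ne_zero_iff.2 hx))

theorem axialRatio_smul {r : ℝ} (hr : r ≠ 0) (x : V) : axialRatio P (r • x) = axialRatio P x := by
  unfold axialRatio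
  rw [map_smul, norm_smul, norm_smul, mul_pow, mul_pow, mul_div_mul_left]
  exact pow_ne_zero _ (norm_ne_zero_iff.2 hr)

theorem axialForm_smul (P : V →ₗ[ℝ] W) (ε : ℝ) (p : ℝ → ℝ) (r : ℝ) (x : V) :
    axialForm P ε p (r • x) = r ^ 2 * axialForm P ε p x := by
  rcases eq_or_ne r 0 with rfl | hr
  · simp [axialForm]
  · rw [axialForm, axialForm, axialRatio_smul hr, norm_smul, mul_pow, Real.norm_eq_abs, sq_abs,
      mul_assoc]

theorem norm_sq_lt_axialForm (hP : ∀ x, ‖P x‖ ≤ ‖x‖) {p : ℝ → ℝ} {ε : ℝ} (hε : 0 < ε)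
    (hp : ∀ s ∈ Set.Icc (0 : ℝ) 1, 0 < p s) {x : V} (hx : x ≠ 0) :
    ‖x‖ ^ 2 < axialForm P ε p x := by
  have hnorm : 0 < ‖x‖ ^ 2 := pow_pos (norm_pos_iff.2 hx) 2
  exact lt_mul_of_one_lt_right hnorm
    (lt_add_of_pos_right 1 (mul_pos hε (hp _ (axialRatio_mem hP x))))

-- A supporting line `p a + l (s - a)` of `p` turns into a quadratic form touching `axialForm`
-- from below; for small `ε` the term `|x|²` makes this form non-negative.
theorem convexOn_axialForm (hP : ∀ x, ‖P x‖ ≤ ‖x‖) {p : ℝ → ℝ} {D ε : ℝ}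
    (hp : ∀ s ∈ Set.Icc (0 : ℝ) 1, 0 ≤ p s)
    (hsupp : ∀ a ∈ Set.Icc (0 : ℝ) 1, ∃ l : ℝ, |l| ≤ D ∧
      ∀ s ∈ Set.Icc (0 : ℝ) 1, p a + l * (s - a) ≤ p s)
    (hε : 0 ≤ ε) (hεD : ε * D ≤ 1) :
    ConvexOn ℝ Set.univ (axialForm P ε p) := by
  refine convexOn_of_forall_exists_convexOn_le fun z => ?_
  set a := axialRatio P z
  have ha : a ∈ Set.Icc (0 : ℝ) 1 := axialRatio_mem hP z
  obtain ⟨l, hlD, hl⟩ := hsupp a ha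
  have hform (x : V) : (1 + ε * (p a - l * a)) * ‖x‖ ^ 2 + ε * l * ‖P x‖ ^ 2 =
      ‖x‖ ^ 2 * (1 + ε * (p a + l * (axialRatio P x - a))) := by
    rw [← norm_sq_mul_axialRatio P x]
    ring
  refine ⟨_, convexOn_norm_sq_add_norm_sq_map fun x => ?_, hform z |>.trans ?_, fun x => ?_⟩
  · rw [hform]
    have hx := axialRatio_mem hP x
    have hdist : |axialRatio P x - a| ≤ 1 := abs_le.2 ⟨by linarith [hx.1, ha.2],
      by linarith [hx.2, ha.1]⟩
    have hslope : |ε * (l * (axialRatio P x - a))| ≤ 1 := by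
      rw [abs_mul, abs_mul, abs_of_nonneg hε]
      calc ε * (|l| * |axialRatio P x - a|) ≤ ε * (D * 1) := by
            gcongr
            exact (abs_nonneg l).trans hlD
        _ ≤ 1 := by rwa [mul_one]
    have hpa := mul_nonneg hε (hp a ha)
    exact mul_nonneg (by positivity) (by linarith [neg_le_of_abs_le hslope])
  · simp only [a, sub_self, mul_zero, add_zero, axialForm]
  · rw [hform, axialForm]
    gcongr
    exact hl _ (axialRatio_mem hP x)

theorem exists_convexOn_axialForm (hP : ∀ x, ‖P x‖ ≤ ‖x‖) {p p' : ℝ → ℝ}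
    (hp : ∀ s ∈ Set.Icc (0 : ℝ) 1, 0 ≤ p s) (hconv : ConvexOn ℝ (Set.Icc 0 1) p)
    (hderiv : ∀ s ∈ Set.Icc (0 : ℝ) 1, HasDerivAt p (p' s) s)
    (hcont : ContinuousOn p' (Set.Icc 0 1)) :
    ∃ ε₀ > 0, ∀ ε, 0 ≤ ε → ε ≤ ε₀ → ConvexOn ℝ Set.univ (axialForm P ε p) := by
  obtain ⟨D, hD⟩ := isCompact_Icc.exists_bound_of_continuousOn hcont
  have hD0 : 0 ≤ D := (norm_nonneg _).trans (hD 0 (by simp))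
  refine ⟨(D + 1)⁻¹, by positivity, fun ε hε hεD => convexOn_axialForm (D := D) hP hp
    (fun a ha => ⟨p' a, hD a ha, fun s hs =>
      add_mul_sub_le_of_convexOn hconv ha (hderiv a ha) hs⟩) hε ?_⟩
  calc ε * D ≤ (D + 1)⁻¹ * (D + 1) := by gcongr; linarith
    _ = 1 := inv_mul_cancel₀ (by positivity)

theorem gauge_sublevel_of_homogeneous {Q : V → ℝ} (hom : ∀ (r : ℝ) x, Q (r • x) = r ^ 2 * Q x)
    (hpos : ∀ x, x ≠ 0 → 0 < Q x) (x : V) : gauge {x | Q x ≤ 1} x = √(Q x) := by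
  rcases eq_or_ne x 0 with rfl | hx
  · have hzero : Q 0 = 0 := by simpa using hom 0 0
    simp [hzero]
  have hscale : {r ∈ Set.Ioi (0 : ℝ) | r⁻¹ • x ∈ {x | Q x ≤ 1}} = Set.Ici (√(Q x)) := by
    ext r
    simp only [Set.mem_Ioi, Set.mem_ofPred_eq, Set.mem_Ici, hom]
    refine ⟨fun ⟨hr, hle⟩ => ?_, fun hle => ?_⟩
    · rw [inv_pow, inv_mul_le_iff₀ (by positivity), mul_one] at hle
      exact Real.sqrt_le_iff.2 ⟨hr.le, hle⟩
    · have hr : 0 < r := (Real.sqrt_pos.2 (hpos x hx)).trans_le hle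
      rw [inv_pow, inv_mul_le_iff₀ (by positivity), mul_one]
      exact ⟨hr, (Real.sqrt_le_iff.1 hle).2⟩
  rw [gauge_def', hscale, csInf_Ici]

end AxialForm

section AxialBody

variable {n : ℕ}

theorem exists_isAdmissible_gauge_eq_sqrt {Q : RSpace n → ℝ} (hconv : ConvexOn ℝ Set.univ Q)
    (hom : ∀ (r : ℝ) x, Q (r • x) = r ^ 2 * Q x) (hrot : ∀ t x, Q (rot t x) = Q x)
    (hlt : ∀ x, x ≠ 0 → ‖x‖ ^ 2 < Q x) :
    ∃ K : ConvexBody (RSpace n), IsAdmissible K ∧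
      ∀ x, gauge (K : Set (RSpace n)) x = √(Q x) := by
  have hcont : Continuous Q := continuousOn_univ.1 (hconv.continuousOn isOpen_univ)
  have hzero : Q 0 = 0 := by simpa using hom 0 0
  have hball : {x | Q x ≤ 1} ⊆ Metric.ball (0 : RSpace n) 1 := fun x (hx : Q x ≤ 1) => by
    rcases eq_or_ne x 0 with rfl | hx0
    · simp
    · exact mem_ball_zero_iff.2 (by nlinarith [hlt x hx0, norm_nonneg x])
  have hgauge (x : RSpace n) : gauge {x | Q x ≤ 1} x = √(Q x) :=
    gauge_sublevel_of_homogeneous hom (fun x hx => (sq_nonneg ‖x‖).trans_lt (hlt x hx)) x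
  refine ⟨{ carrier := {x | Q x ≤ 1}
            convex' := by simpa using hconv.convex_le 1
            isCompact' := Metric.isCompact_of_isClosed_isBounded
              (isClosed_le hcont continuous_const) (Metric.isBounded_ball.subset hball)
            nonempty' := ⟨0, by simp [hzero]⟩ },
    { zero_mem_interior := ?_
      rotInvariant := fun t _ x => ?_
      subset_ball := hball }, hgauge⟩
  · have hnhds : ∀ᶠ x in nhds (0 : RSpace n), Q x < 1 :=
      hcont.continuousAt.eventually_lt continuousAt_const (hzero ▸ one_pos)
    exact mem_interior_iff_mem_nhds.2 (hnhds.mono fun x hx => hx.le)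
  · exact (hgauge _).trans (hrot t x ▸ (hgauge x).symm)

/-- The `k`-th complex coordinate as a real-linear map. -/
def coordMap (k : Fin n) : RSpace n →ₗ[ℝ] ℂ where
  toFun x := toComplex x k
  map_add' x y := by apply Complex.ext <;> simp [toComplex]
  map_smul' r x := by apply Complex.ext <;> simp [toComplex]

theorem norm_sq_coordMap (k : Fin n) (x : RSpace n) :
    ‖coordMap k x‖ ^ 2 = x (k, 0) ^ 2 + x (k, 1) ^ 2 := by
  rw [Complex.sq_norm, Complex.normSq_apply]
  simp [coordMap, toComplex, pow_two]

theorem norm_sq_eq_sum_coordMap (x : RSpace n) : ‖x‖ ^ 2 = ∑ k, ‖coordMap k x‖ ^ 2 := by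
  simp only [norm_sq_eq, norm_sq_coordMap]

theorem norm_coordMap_le (k : Fin n) (x : RSpace n) : ‖coordMap k x‖ ≤ ‖x‖ := by
  rw [← sq_le_sq₀ (norm_nonneg _) (norm_nonneg _), norm_sq_eq_sum_coordMap]
  exact Finset.single_le_sum (f := fun k => ‖coordMap k x‖ ^ 2) (fun _ _ => by positivity)
    (Finset.mem_univ k)

theorem norm_coordMap_rot (k : Fin n) (t : ℝ) (x : RSpace n) :
    ‖coordMap k (rot t x)‖ = ‖coordMap k x‖ := by
  change ‖toComplex (rot t x) k‖ = ‖toComplex x k‖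
  rw [toComplex_rot, norm_mul, Complex.norm_exp_ofReal_mul_I, one_mul]

theorem norm_rot (t : ℝ) (x : RSpace n) : ‖rot t x‖ = ‖x‖ := by
  rw [← sq_eq_sq₀ (norm_nonneg _) (norm_nonneg _), norm_sq_eq_sum_coordMap,
    norm_sq_eq_sum_coordMap]
  simp only [norm_coordMap_rot]

theorem exists_isAdmissible_bpFunction_eq_inv (k : Fin n) {p p' : ℝ → ℝ}
    (hp : ∀ s ∈ Set.Icc (0 : ℝ) 1, 0 < p s) (hconv : ConvexOn ℝ (Set.Icc 0 1) p)
    (hderiv : ∀ s ∈ Set.Icc (0 : ℝ) 1, HasDerivAt p (p' s) s)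
    (hcont : ContinuousOn p' (Set.Icc 0 1)) :
    ∃ ε₀ > 0, ∀ ε, 0 < ε → ε ≤ ε₀ → ∃ K : ConvexBody (RSpace n), IsAdmissible K ∧
      ∀ x, ‖x‖ = 1 → bpFunction (K : Set (RSpace n)) x = (ε * p (‖coordMap k x‖ ^ 2))⁻¹ := by
  have hP := norm_coordMap_le k
  obtain ⟨ε₀, hε₀, hform⟩ := exists_convexOn_axialForm hP (fun s hs => (hp s hs).le) hconv hderiv
    hcont
  refine ⟨ε₀, hε₀, fun ε hε hε' => ?_⟩
  have hlt (x : RSpace n) (hx : x ≠ 0) := norm_sq_lt_axialForm hP hε hp hx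
  obtain ⟨K, hK, hgauge⟩ := exists_isAdmissible_gauge_eq_sqrt (hform ε hε.le hε')
    (axialForm_smul _ ε p) (fun t x => by simp only [axialForm, axialRatio, norm_rot,
      norm_coordMap_rot]) hlt
  refine ⟨K, hK, fun x hx => ?_⟩
  have hx0 : x ≠ 0 := norm_ne_zero_iff.1 (hx ▸ one_ne_zero)
  rw [hK.bpFunction_of_norm_eq_one hx, hgauge,
    Real.sq_sqrt ((sq_nonneg ‖x‖).trans (hlt x hx0).le)]
  simp [axialForm, axialRatio, hx]

end AxialBody

section CompactIntegral

variable {X : Type*} [TopologicalSpace X] [CompactSpace X] [MeasurableSpace X] [BorelSpace X]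
  (μ : Measure X) [IsFiniteMeasure μ]

theorem mul_sq_max_sub_inv_le_mul_exp {c : ℝ} (hc : 0 < c) (y : ℝ) :
    c * max y 0 ^ 2 - c⁻¹ ≤ y * Real.exp (c * y) := by
  rcases le_total 0 y with hy | hy
  · rw [max_eq_left hy]
    calc c * y ^ 2 - c⁻¹ ≤ y * (c * y) := by linarith [inv_pos.2 hc]
      _ ≤ y * Real.exp (c * y) := by
        gcongr
        linarith [Real.add_one_le_exp (c * y)]
  · rw [max_eq_right hy]
    have hexp : -(c * y) * Real.exp (c * y) ≤ 1 :=
      calc -(c * y) * Real.exp (c * y) ≤ Real.exp (-(c * y)) * Real.exp (c * y) := by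
            gcongr
            linarith [Real.add_one_le_exp (-(c * y))]
        _ = 1 := by rw [← Real.exp_add, neg_add_cancel, Real.exp_zero]
    have hdiv : c⁻¹ * (-(c * y) * Real.exp (c * y)) = -(y * Real.exp (c * y)) := by field_simp
    linarith [mul_le_mul_of_nonneg_left hexp (inv_pos.2 hc).le]

theorem exists_integral_mul_exp_pos [μ.IsOpenPosMeasure] {y : X → ℝ} (hy : Continuous y) {x₀ : X}
    (hx₀ : 0 < y x₀) : ∃ c > 0, 0 < ∫ x, y x * Real.exp (c * y x) ∂μ := by
  have hA : 0 < ∫ x, max (y x) 0 ^ 2 ∂μ :=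
    Continuous.integral_pos_of_hasCompactSupport_nonneg_nonzero (by fun_prop)
      (HasCompactSupport.of_compactSpace _) (fun x => sq_nonneg _) (x := x₀)
      (pow_ne_zero 2 (lt_max_of_lt_left hx₀).ne')
  set A := ∫ x, max (y x) 0 ^ 2 ∂μ
  set c := μ.real Set.univ / A + 1 with hc
  have hc1 : 1 ≤ c := le_add_of_nonneg_left (by positivity)
  have hc0 : 0 < c := one_pos.trans_le hc1
  refine ⟨c, hc0, ?_⟩
  have hlower : c * A - μ.real Set.univ * c⁻¹ ≤ ∫ x, y x * Real.exp (c * y x) ∂μ := by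
    rw [← integral_const_mul, ← smul_eq_mul (μ.real _), ← integral_const, ← integral_sub
      (integrable_of_continuous (by fun_prop)) (integrable_const _)]
    exact integral_mono (integrable_of_continuous (by fun_prop))
      (integrable_of_continuous (by fun_prop))
      fun x => mul_sq_max_sub_inv_le_mul_exp hc0 (y x)
  have hcA : c * A = μ.real Set.univ + A := by
    rw [hc, add_mul, div_mul_cancel₀ _ hA.ne', one_mul]
  have hinv : μ.real Set.univ * c⁻¹ ≤ μ.real Set.univ :=
    mul_le_of_le_one_right measureReal_nonneg (inv_le_one_of_one_le₀ hc1)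
  linarith

theorem succ_mul_pow_mul_le (m : ℕ) {a b : ℝ} (ha : 0 < a) (hb : 0 < b) :
    (m + 1) * (a ^ m * b) ≤ m * a ^ (m + 1) + b ^ (m + 1) := by
  have hbernoulli := one_add_mul_le_pow (a := b / a - 1) (by linarith [div_pos hb ha]) (m + 1)
  rw [add_sub_cancel, div_pow, le_div_iff₀ (by positivity)] at hbernoulli
  have hexpand : (1 + ((m + 1 : ℕ) : ℝ) * (b / a - 1)) * a ^ (m + 1) =
      (m + 1) * (a ^ m * b) - m * a ^ (m + 1) := by
    push_cast
    field_simp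
    ring
  linarith

theorem integral_pow_succ_lt_of_lt_integral_pow_mul (m : ℕ) {f g : X → ℝ} (hf : Continuous f)
    (hg : Continuous g) (hfpos : ∀ x, 0 < f x) (hgpos : ∀ x, 0 < g x)
    (hlt : ∫ x, g x ^ (m + 1) ∂μ < ∫ x, f x ^ m * g x ∂μ) :
    ∫ x, g x ^ (m + 1) ∂μ < ∫ x, f x ^ (m + 1) ∂μ := by
  have hyoung : (m + 1) * ∫ x, f x ^ m * g x ∂μ ≤
      m * ∫ x, f x ^ (m + 1) ∂μ + ∫ x, g x ^ (m + 1) ∂μ := by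
    rw [← integral_const_mul, ← integral_const_mul,
      ← integral_add (integrable_of_continuous (by fun_prop))
        (integrable_of_continuous (by fun_prop))]
    exact integral_mono (integrable_of_continuous (by fun_prop))
      (integrable_of_continuous (by fun_prop))
      fun x => succ_mul_pow_mul_le m (hfpos x) (hgpos x)
  refine lt_of_mul_lt_mul_left (a := (m : ℝ)) ?_ m.cast_nonneg
  linarith [mul_lt_mul_of_pos_left hlt (by positivity : (0 : ℝ) < m + 1)]

end CompactIntegral

section PerturbedExponential

theorem convexOn_rpow_neg {S : Set ℝ} (hS : Convex ℝ S) {u u' u'' : ℝ → ℝ} {a : ℝ} (ha : 0 ≤ a)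
    (hpos : ∀ s ∈ S, 0 < u s) (hu : ∀ s ∈ S, HasDerivAt u (u' s) s)
    (hu' : ∀ s ∈ S, HasDerivAt u' (u'' s) s)
    (hle : ∀ s ∈ S, u s * u'' s ≤ (1 + a) * u' s ^ 2) : ConvexOn ℝ S fun s => u s ^ (-a) := by
  have hderiv (s) (hs : s ∈ S) := (hu s hs).rpow_const (p := -a) (Or.inl (hpos s hs).ne')
  have hderiv2 (s) (hs : s ∈ S) := ((hu' s hs).mul_const (-a)).mul
    ((hu s hs).rpow_const (p := -a - 1) (Or.inl (hpos s hs).ne'))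
  refine convexOn_of_hasDerivWithinAt2_nonneg hS
    (fun s hs => (hderiv s hs).continuousAt.continuousWithinAt)
    (fun s hs => (hderiv s (interior_subset hs)).hasDerivWithinAt)
    (fun s hs => (hderiv2 s (interior_subset hs)).hasDerivWithinAt) fun s hs => ?_
  have hs' := interior_subset hs
  have hpow : u s ^ (-a - 1) = u s ^ (-a - 1 - 1) * u s := by
    rw [← Real.rpow_add_one (hpos s hs').ne', sub_add_cancel]
  calc 0 ≤ a * u s ^ (-a - 1 - 1) * ((1 + a) * u' s ^ 2 - u s * u'' s) :=
        mul_nonneg (mul_nonneg ha (Real.rpow_nonneg (hpos s hs').le _)) (sub_nonneg.2 (hle s hs'))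
    _ = _ := by rw [hpow]; ring

variable {m c τ : ℝ}

/-- The perturbation `exp (m c s) + τ (m s - 1)` of the `m`-th power of `exp (c s)`. -/
def perturbedExp (m c τ s : ℝ) : ℝ := Real.exp (m * c * s) + τ * (m * s - 1)

theorem perturbedExp_pos (hm : 1 < m) (hc : 0 ≤ c) (hτ : τ ∈ Set.Icc 0 (m ^ 2)⁻¹) {s : ℝ}
    (hs : 0 ≤ s) : 0 < perturbedExp m c τ s := by
  have hexp : 1 ≤ Real.exp (m * c * s) := Real.one_le_exp (by positivity)
  have hτ1 : τ < 1 := hτ.2.trans_lt (inv_lt_one_of_one_lt₀ (one_lt_pow₀ hm two_ne_zero))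
  have hτms : 0 ≤ τ * (m * s) := mul_nonneg hτ.1 (by positivity)
  unfold perturbedExp
  linarith

theorem perturbedExp_le (hm : 1 < m) (hc : 0 ≤ c) (hτ : τ ∈ Set.Icc 0 (m ^ 2)⁻¹) {s : ℝ}
    (hs : s ∈ Set.Icc (0 : ℝ) 1) :
    perturbedExp m c τ s ≤ (1 + 1 / m) * Real.exp (m * c * s) := by
  have hs0 := hs.1
  have hexp : 1 ≤ Real.exp (m * c * s) := Real.one_le_exp (by positivity)
  have hms : m * s - 1 ≤ m := by nlinarith [hs.2]
  calc perturbedExp m c τ s ≤ Real.exp (m * c * s) + (m ^ 2)⁻¹ * m := by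
        unfold perturbedExp
        exact add_le_add_right ((mul_le_mul_of_nonneg_left hms hτ.1).trans
          (mul_le_mul_of_nonneg_right hτ.2 (by positivity))) _
    _ = Real.exp (m * c * s) + 1 / m * 1 := by field_simp
    _ ≤ Real.exp (m * c * s) + 1 / m * Real.exp (m * c * s) := by gcongr
    _ = _ := by ring

theorem hasDerivAt_perturbedExp (m c τ s : ℝ) :
    HasDerivAt (perturbedExp m c τ) (m * c * Real.exp (m * c * s) + τ * m) s := by
  have hexp := ((hasDerivAt_id s).const_mul (m * c)).exp
  have hlin := (((hasDerivAt_id s).const_mul m).sub_const 1).const_mul τ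
  exact (hexp.add hlin).congr_deriv (by simp only [id, mul_one]; ring)

theorem hasDerivAt_deriv_perturbedExp (m c τ s : ℝ) :
    HasDerivAt (fun s => m * c * Real.exp (m * c * s) + τ * m)
      ((m * c) ^ 2 * Real.exp (m * c * s)) s := by
  have hexp := (((hasDerivAt_id s).const_mul (m * c)).exp.const_mul (m * c)).add_const (τ * m)
  exact hexp.congr_deriv (by simp only [id, mul_one]; ring)

theorem convexOn_perturbedExp_rpow (hm : 1 < m) (hc : 0 ≤ c) (hτ : τ ∈ Set.Icc 0 (m ^ 2)⁻¹) :
    ConvexOn ℝ (Set.Icc 0 1) fun s => perturbedExp m c τ s ^ (-(1 / m)) := by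
  refine convexOn_rpow_neg (convex_Icc 0 1) (by positivity)
    (fun s hs => perturbedExp_pos hm hc hτ hs.1) (fun s _ => hasDerivAt_perturbedExp m c τ s)
    (fun s _ => hasDerivAt_deriv_perturbedExp m c τ s) fun s hs => ?_
  set E := Real.exp (m * c * s)
  calc perturbedExp m c τ s * ((m * c) ^ 2 * E) ≤ (1 + 1 / m) * E * ((m * c) ^ 2 * E) := by
        gcongr
        exact perturbedExp_le hm hc hτ hs
    _ = (1 + 1 / m) * (m * c * E) ^ 2 := by ring
    _ ≤ (1 + 1 / m) * (m * c * E + τ * m) ^ 2 := by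
        gcongr
        exact le_add_of_nonneg_right (mul_nonneg hτ.1 (by positivity))

end PerturbedExponential

section NegativeAnswer

variable {n m : ℕ}

/-- The function `m |x_k|² - 1`. On the unit sphere of a complex hyperplane of `ℂᵐ⁺¹` its mean is
non-positive. -/
def axialExcess (m : ℕ) (k : Fin n) (x : RSpace n) : ℝ := m * ‖coordMap k x‖ ^ 2 - 1

theorem continuous_coordMap (k : Fin n) : Continuous (coordMap k) :=
  (coordMap k).continuous_of_finiteDimensional

theorem continuous_axialExcess (m : ℕ) (k : Fin n) : Continuous (axialExcess m k) :=
  (continuous_const.mul ((continuous_coordMap k).norm.pow 2)).sub continuous_const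

theorem norm_sq_coordMap_mem (k : Fin n) {x : RSpace n} (hx : ‖x‖ = 1) :
    ‖coordMap k x‖ ^ 2 ∈ Set.Icc (0 : ℝ) 1 :=
  ⟨by positivity, pow_le_one₀ (norm_nonneg _) (hx ▸ norm_coordMap_le k x)⟩

theorem exists_isAdmissible_bpFunction_eq_perturbedExp_rpow (hm : 2 ≤ m) (k : Fin n) {c τ : ℝ}
    (hc : 0 ≤ c) (hτ : τ ∈ Set.Icc 0 ((m : ℝ) ^ 2)⁻¹) :
    ∃ ε₀ > 0, ∀ ε, 0 < ε → ε ≤ ε₀ → ∃ K : ConvexBody (RSpace n), IsAdmissible K ∧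
      ∀ x, ‖x‖ = 1 → bpFunction (K : Set (RSpace n)) x =
        ε⁻¹ * perturbedExp m c τ (‖coordMap k x‖ ^ 2) ^ (1 / m : ℝ) := by
  have hm1 : (1 : ℝ) < m := by exact_mod_cast hm
  have hpos (s) (hs : s ∈ Set.Icc (0 : ℝ) 1) := perturbedExp_pos hm1 hc hτ hs.1
  obtain ⟨ε₀, hε₀, hbody⟩ := exists_isAdmissible_bpFunction_eq_inv k
    (fun s hs => Real.rpow_pos_of_pos (hpos s hs) _) (convexOn_perturbedExp_rpow hm1 hc hτ)
    (fun s hs => (hasDerivAt_perturbedExp m c τ s).rpow_const (Or.inl (hpos s hs).ne'))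
    (ContinuousOn.mul (by fun_prop) (ContinuousOn.rpow_const
      (fun s _ => (hasDerivAt_perturbedExp m c τ s).continuousAt.continuousWithinAt)
      fun s hs => Or.inl (hpos s hs).ne'))
  refine ⟨ε₀, hε₀, fun ε hε hε' => ?_⟩
  obtain ⟨K, hK, hbp⟩ := hbody ε hε hε'
  refine ⟨K, hK, fun x hx => ?_⟩
  rw [hbp x hx, mul_inv, ← Real.rpow_neg (hpos _ (norm_sq_coordMap_mem k hx)).le, neg_neg]

theorem exists_integral_exp_mul_axialExcess_pos (hm : 2 ≤ m) (k : Fin n) :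
    ∃ c > 0, 0 < ∫ θ : Metric.sphere (0 : RSpace n) 1,
      Real.exp (c * ‖coordMap k θ‖ ^ 2) * axialExcess m k θ ∂sphereMeasure (RSpace n) := by
  have hm1 : (1 : ℝ) < m := by exact_mod_cast hm
  let axis : Metric.sphere (0 : RSpace n) 1 := ⟨EuclideanSpace.single (k, 0) 1, by simp⟩
  have haxis : 0 < axialExcess m k axis := by simpa [axialExcess, axis, norm_sq_coordMap] using hm1
  obtain ⟨c, hc, hpos⟩ := exists_integral_mul_exp_pos (sphereMeasure (RSpace n))
    ((continuous_axialExcess m k).comp continuous_subtype_val) haxis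
  refine ⟨c * m, by positivity, ?_⟩
  have hshift (θ : Metric.sphere (0 : RSpace n) 1) :
      Real.exp (c * m * ‖coordMap k θ‖ ^ 2) * axialExcess m k θ =
        Real.exp c * (axialExcess m k θ * Real.exp (c * axialExcess m k θ)) := by
    have hexp : c * m * ‖coordMap k θ‖ ^ 2 = c + c * axialExcess m k θ := by
      unfold axialExcess
      ring
    rw [hexp, Real.exp_add]
    ring
  simp only [hshift, integral_const_mul]
  exact mul_pos (Real.exp_pos c) hpos

theorem exists_isAdmissible_pow_eq_add_axialExcess (hm : 2 ≤ m) (k : Fin n) :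
    ∃ K L : ConvexBody (RSpace n), IsAdmissible K ∧ IsAdmissible L ∧
      (∃ δ > 0, ∀ x, ‖x‖ = 1 → bpFunction (K : Set (RSpace n)) x ^ m =
        bpFunction (L : Set (RSpace n)) x ^ m + δ * axialExcess m k x) ∧
      0 < ∫ θ : Metric.sphere (0 : RSpace n) 1,
        bpFunction (L : Set (RSpace n)) θ * axialExcess m k θ ∂sphereMeasure (RSpace n) := by
  have hm0 : (m : ℝ) ≠ 0 := by positivity
  obtain ⟨c, hc, hpos⟩ := exists_integral_exp_mul_axialExcess_pos hm k
  set τ : ℝ := ((m : ℝ) ^ 2)⁻¹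
  have hτ : 0 < τ := by positivity
  obtain ⟨ε₁, hε₁, hbody₁⟩ :=
    exists_isAdmissible_bpFunction_eq_perturbedExp_rpow hm k hc.le (τ := τ) ⟨hτ.le, le_rfl⟩
  obtain ⟨ε₂, hε₂, hbody₂⟩ :=
    exists_isAdmissible_bpFunction_eq_perturbedExp_rpow hm k hc.le (τ := 0) ⟨le_rfl, hτ.le⟩
  have hε : 0 < min ε₁ ε₂ := lt_min hε₁ hε₂
  set ε := min ε₁ ε₂
  obtain ⟨K, hK, hfK⟩ := hbody₁ ε hε (min_le_left _ _)
  obtain ⟨L, hL, hfL⟩ := hbody₂ ε hε (min_le_right _ _)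
  replace hfL (x : RSpace n) (hx : ‖x‖ = 1) : bpFunction (L : Set (RSpace n)) x =
      ε⁻¹ * Real.exp (c * ‖coordMap k x‖ ^ 2) := by
    rw [hfL x hx, perturbedExp, zero_mul, add_zero, ← Real.exp_mul]
    congr 2
    field_simp
  refine ⟨K, L, hK, hL, ⟨ε⁻¹ ^ m * τ, by positivity, fun x hx => ?_⟩, ?_⟩
  · have hpert : 0 < perturbedExp m c τ (‖coordMap k x‖ ^ 2) :=
      perturbedExp_pos (by exact_mod_cast hm) hc.le ⟨hτ.le, le_rfl⟩ (sq_nonneg _)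
    rw [hfK x hx, hfL x hx, mul_pow, mul_pow, ← Real.rpow_natCast (_ ^ (1 / m : ℝ)),
      ← Real.rpow_mul hpert.le, one_div, inv_mul_cancel₀ hm0, Real.rpow_one, ← Real.exp_nat_mul,
      perturbedExp, axialExcess]
    ring_nf
  · simp only [hfL _ (norm_eq_of_mem_sphere _), mul_assoc, integral_const_mul]
    positivity

theorem finrank_mul_integral_sphere_submodule_inner_sq_le {V : Type*} [NormedAddCommGroup V]
    [InnerProductSpace ℝ V] [FiniteDimensional ℝ V] [MeasurableSpace V] [BorelSpace V]
    (H : Submodule ℝ V) (e : V) :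
    Module.finrank ℝ H * ∫ θ : Metric.sphere (0 : H) 1, inner ℝ ((θ : H) : V) e ^ 2
      ∂sphereMeasure H ≤ ‖e‖ ^ 2 * (sphereMeasure H).real Set.univ := by
  have hmoment := finrank_mul_integral_sphere_inner_sq (V := H) (H.orthogonalProjectionOnto e)
  have hproj (x : H) : inner ℝ x (H.orthogonalProjectionOnto e) = inner ℝ (x : V) e := by
    rw [Submodule.coe_inner, ← Submodule.starProjection_apply,
      ← Submodule.inner_starProjection_left_eq_right, Submodule.starProjection_eq_self_iff.2 x.2]
  simp only [hproj] at hmoment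
  rw [hmoment]
  gcongr
  exact Submodule.norm_orthogonalProjectionOnto_apply_le _ _

theorem integral_axialExcess_hyperplane_nonpos (k : Fin (m + 1))
    {ξ : RSpace (m + 1)} (hξ : ‖ξ‖ = 1) :
    ∫ θ : Metric.sphere (0 : hyperplane ξ) 1,
      axialExcess m k ((θ : hyperplane ξ) : RSpace (m + 1)) ∂sphereMeasure (hyperplane ξ) ≤ 0 := by
  have hmoment (p : Fin (m + 1) × Fin 2) : 2 * m * ∫ θ : Metric.sphere (0 : hyperplane ξ) 1,
      ((θ : hyperplane ξ) : RSpace (m + 1)) p ^ 2 ∂sphereMeasure (hyperplane ξ) ≤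
        (sphereMeasure (hyperplane ξ)).real Set.univ := by
    simpa [finrank_hyperplane hξ, EuclideanSpace.inner_single_right] using
      finrank_mul_integral_sphere_submodule_inner_sq_le (hyperplane ξ)
        (EuclideanSpace.single p (1 : ℝ))
  have hintegrable (p : Fin (m + 1) × Fin 2) : Integrable (fun θ : Metric.sphere
      (0 : hyperplane ξ) 1 => ((θ : hyperplane ξ) : RSpace (m + 1)) p ^ 2)
      (sphereMeasure (hyperplane ξ)) := integrable_of_continuous (by fun_prop)
  simp only [axialExcess, norm_sq_coordMap]
  rw [integral_sub (((hintegrable _).fun_add (hintegrable _)).const_mul _) (integrable_const _),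
    integral_const_mul, integral_add (hintegrable _) (hintegrable _), integral_const,
    smul_eq_mul, mul_one]
  linarith [hmoment (k, 0), hmoment (k, 1)]

variable {K L : ConvexBody (RSpace (m + 1))} {k : Fin (m + 1)} {δ : ℝ}

theorem hvolSection_le_of_pow_eq_add_axialExcess (hm : 1 ≤ m) (hK : IsAdmissible K)
    (hL : IsAdmissible L) (hδ : 0 ≤ δ)
    (hpow : ∀ x, ‖x‖ = 1 → bpFunction (K : Set (RSpace (m + 1))) x ^ m =
      bpFunction (L : Set (RSpace (m + 1))) x ^ m + δ * axialExcess m k x)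
    {ξ : RSpace (m + 1)} (hξ : ‖ξ‖ = 1) :
    hvolSection (K : Set (RSpace (m + 1))) ξ ≤ hvolSection (L : Set (RSpace (m + 1))) ξ := by
  rw [hK.hvolSection_eq (by omega) hξ, hL.hvolSection_eq (by omega) hξ]
  refine ENNReal.ofReal_le_ofReal (mul_le_mul_of_nonneg_left ?_ (by positivity))
  have hunit (θ : Metric.sphere (0 : hyperplane ξ) 1) :
      ‖((θ : hyperplane ξ) : RSpace (m + 1))‖ = 1 := norm_eq_of_mem_sphere θ
  have hfL : Continuous fun θ : Metric.sphere (0 : hyperplane ξ) 1 =>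
      bpFunction (L : Set (RSpace (m + 1))) ((θ : hyperplane ξ) : RSpace (m + 1)) ^ m :=
    (hL.continuousOn_bpFunction.comp_continuous (by fun_prop)
      fun θ => norm_ne_zero_iff.1 ((hunit θ).trans_ne one_ne_zero)).pow m
  have hexcess := continuous_axialExcess m k
  simp only [Nat.add_sub_cancel, hpow _ (hunit _)]
  rw [integral_add (integrable_of_continuous hfL) (integrable_of_continuous (by fun_prop)),
    integral_const_mul]
  exact add_le_of_nonpos_right (mul_nonpos_of_nonneg_of_nonpos hδ
    (integral_axialExcess_hyperplane_nonpos k hξ))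

theorem hvol_lt_of_pow_eq_add_axialExcess (hK : IsAdmissible K) (hL : IsAdmissible L)
    (hδ : 0 < δ)
    (hpow : ∀ x, ‖x‖ = 1 → bpFunction (K : Set (RSpace (m + 1))) x ^ m =
      bpFunction (L : Set (RSpace (m + 1))) x ^ m + δ * axialExcess m k x)
    (hpos : 0 < ∫ θ : Metric.sphere (0 : RSpace (m + 1)) 1,
      bpFunction (L : Set (RSpace (m + 1))) θ * axialExcess m k θ
        ∂sphereMeasure (RSpace (m + 1))) :
    hvol (L : Set (RSpace (m + 1))) < hvol (K : Set (RSpace (m + 1))) := by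
  have hfK := hK.continuous_bpFunction_sphere
  have hfL := hL.continuous_bpFunction_sphere
  have hexcess := continuous_axialExcess m k
  have hposK (θ : Metric.sphere (0 : RSpace (m + 1)) 1) :=
    hK.bpFunction_pos (ne_zero_of_mem_unit_sphere θ)
  have hposL (θ : Metric.sphere (0 : RSpace (m + 1)) 1) :=
    hL.bpFunction_pos (ne_zero_of_mem_unit_sphere θ)
  have hlt := integral_pow_succ_lt_of_lt_integral_pow_mul (sphereMeasure (RSpace (m + 1))) m
    hfK hfL hposK hposL (by
      simp only [hpow _ (norm_eq_of_mem_sphere _), add_mul, ← pow_succ, mul_assoc,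
        mul_comm (axialExcess _ _ _)]
      rw [integral_add (integrable_of_continuous (by fun_prop))
        (integrable_of_continuous (by fun_prop)), integral_const_mul]
      exact lt_add_of_pos_right _ (mul_pos hδ hpos))
  have hnonneg : 0 ≤ ∫ θ : Metric.sphere (0 : RSpace (m + 1)) 1,
      bpFunction (L : Set (RSpace (m + 1))) θ ^ (m + 1) ∂sphereMeasure (RSpace (m + 1)) :=
    integral_nonneg fun θ => pow_nonneg (hposL θ).le _
  rw [hK.hvol_eq m.succ_pos, hL.hvol_eq m.succ_pos,
    ENNReal.ofReal_lt_ofReal_iff (mul_pos (by positivity) (hnonneg.trans_lt hlt))]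
  gcongr

theorem not_busemannPettyAffirmative (hn : 3 ≤ n) : ¬ BusemannPettyAffirmative n := by
  obtain ⟨m, rfl⟩ := Nat.exists_eq_add_of_le' (show 1 ≤ n by omega)
  obtain ⟨K, L, hK, hL, ⟨δ, hδ, hpow⟩, hpos⟩ :=
    exists_isAdmissible_pow_eq_add_axialExcess (by omega : 2 ≤ m) (0 : Fin (m + 1))
  intro haffirmative
  refine (hvol_lt_of_pow_eq_add_axialExcess hK hL hδ hpow hpos).not_ge
    (haffirmative K L hK hL fun ξ hξ => ?_)
  exact hvolSection_le_of_pow_eq_add_axialExcess (by omega) hK hL hδ.le hpow hξ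

end NegativeAnswer

section Gaussian

theorem norm_iteratedFDeriv_exp (i : ℕ) (t : ℝ) :
    ‖iteratedFDeriv ℝ i Real.exp t‖ = Real.exp t := by
  rw [norm_iteratedFDeriv_eq_norm_iteratedDeriv, iteratedDeriv_eq_iterate, Real.iter_deriv_exp,
    Real.norm_of_nonneg (Real.exp_pos t).le]

theorem exists_pow_mul_exp_neg_sq_le {b : ℝ} (hb : 0 < b) (N : ℕ) :
    ∃ C, ∀ t : ℝ, 0 ≤ t → (1 + t) ^ N * Real.exp (-(b * t ^ 2)) ≤ C := by
  refine ⟨N.factorial * Real.exp (1 + 1 / (4 * b)), fun t ht => ?_⟩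
  have hpow : (1 + t) ^ N ≤ N.factorial * Real.exp (1 + t) := by
    rw [← div_le_iff₀' (by positivity)]
    exact Real.pow_div_factorial_le_exp (1 + t) (by positivity) N
  have hsquare : 0 ≤ b * t ^ 2 - t + 1 / (4 * b) := by
    have hcomplete : b * t ^ 2 - t + 1 / (4 * b) = b * (t - 1 / (2 * b)) ^ 2 := by
      field_simp
      ring
    rw [hcomplete]
    positivity
  calc (1 + t) ^ N * Real.exp (-(b * t ^ 2))
      ≤ N.factorial * Real.exp (1 + t) * Real.exp (-(b * t ^ 2)) := by gcongr
    _ = N.factorial * Real.exp (1 + t + -(b * t ^ 2)) := by rw [mul_assoc, ← Real.exp_add]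
    _ ≤ N.factorial * Real.exp (1 + 1 / (4 * b)) := by
        gcongr N.factorial * Real.exp ?_
        linarith

theorem exists_norm_iteratedFDeriv_exp_comp_le {E : Type*} [NormedAddCommGroup E]
    [NormedSpace ℝ E] {f : E → ℝ} (hf : f.HasTemperateGrowth) (i : ℕ) :
    ∃ (N : ℕ) (C : ℝ), 0 ≤ C ∧ ∀ x,
      ‖iteratedFDeriv ℝ i (fun x => Real.exp (f x)) x‖ ≤ C * (1 + ‖x‖) ^ N * Real.exp (f x) := by
  obtain ⟨l, D, hD, hbound⟩ := hf.norm_iteratedFDeriv_le_uniform i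
  refine ⟨l * i, i.factorial * (D + 1) ^ i, by positivity, fun x => ?_⟩
  have hone : 1 ≤ (D + 1) * (1 + ‖x‖) ^ l :=
    one_le_mul_of_one_le_of_one_le (by linarith) (one_le_pow₀ (by linarith [norm_nonneg x]))
  calc ‖iteratedFDeriv ℝ i (fun x => Real.exp (f x)) x‖
      ≤ i.factorial * Real.exp (f x) * ((D + 1) * (1 + ‖x‖) ^ l) ^ i := by
        refine norm_iteratedFDeriv_comp_le (N := (⊤ : ℕ∞)) Real.contDiff_exp hf.1
          (by exact_mod_cast le_top) x (fun j _ => (norm_iteratedFDeriv_exp j _).le)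
          fun j hj hji => (hbound j hji x).trans (le_trans ?_ (le_self_pow₀ hone (by omega)))
        gcongr
        linarith
    _ = i.factorial * (D + 1) ^ i * (1 + ‖x‖) ^ (l * i) * Real.exp (f x) := by
        rw [mul_pow, pow_mul]
        ring

variable {V : Type*} [NormedAddCommGroup V] [InnerProductSpace ℝ V]

theorem exists_norm_pow_mul_norm_iteratedFDeriv_gaussian_le {b : ℝ} (hb : 0 < b) (k i : ℕ) :
    ∃ C, ∀ x : V, ‖x‖ ^ k *
      ‖iteratedFDeriv ℝ i (fun x : V => Real.exp (-(b * ‖x‖ ^ 2))) x‖ ≤ C := by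
  have hgrowth : Function.HasTemperateGrowth fun x : V => -(b * ‖x‖ ^ 2) :=
    ((Function.HasTemperateGrowth.const b).mul (Function.hasTemperateGrowth_norm_sq V)).neg
  obtain ⟨N, C, hC, hderiv⟩ := exists_norm_iteratedFDeriv_exp_comp_le hgrowth i
  obtain ⟨M, hM⟩ := exists_pow_mul_exp_neg_sq_le hb (k + N)
  refine ⟨C * M, fun x => ?_⟩
  calc ‖x‖ ^ k * ‖iteratedFDeriv ℝ i (fun x : V => Real.exp (-(b * ‖x‖ ^ 2))) x‖
      ≤ (1 + ‖x‖) ^ k * (C * (1 + ‖x‖) ^ N * Real.exp (-(b * ‖x‖ ^ 2))) := by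
        gcongr
        · linarith
        · exact hderiv x
    _ = C * ((1 + ‖x‖) ^ (k + N) * Real.exp (-(b * ‖x‖ ^ 2))) := by ring
    _ ≤ C * M := by
        gcongr
        exact hM _ (norm_nonneg x)

/-- The Gaussian `exp (-b |x|²)` as a Schwartz function. -/
def gaussian (V : Type*) [NormedAddCommGroup V] [InnerProductSpace ℝ V] (b : ℝ) (hb : 0 < b) :
    𝓢(V, ℝ) where
  toFun x := Real.exp (-(b * ‖x‖ ^ 2))
  smooth' := Real.contDiff_exp.comp (contDiff_const.mul (contDiff_norm_sq ℝ)).neg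
  decay' k i := exists_norm_pow_mul_norm_iteratedFDeriv_gaussian_le hb k i

theorem gaussian_apply (b : ℝ) (hb : 0 < b) (x : V) :
    gaussian V b hb x = Real.exp (-(b * ‖x‖ ^ 2)) := rfl

theorem hasFDerivAt_gaussian (b : ℝ) (x : V) :
    HasFDerivAt (fun x : V => Real.exp (-(b * ‖x‖ ^ 2)))
      ((-(2 * b) * Real.exp (-(b * ‖x‖ ^ 2))) • innerSL ℝ x) x := by
  refine (((hasStrictFDerivAt_norm_sq x).hasFDerivAt.const_mul b).fun_neg.exp).congr_fderiv ?_
  module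

/-- The Hermite function `⟨x, e⟩ exp (-|x|²)`, against which positive definiteness is tested. -/
def hermiteTest (e : V) : 𝓢(V, ℂ) :=
  SchwartzMap.postcompCLM (𝕜 := ℝ) Complex.ofRealCLM
    (SchwartzMap.smulLeftCLM ℝ (fun x : V => inner ℝ x e) (gaussian V 1 one_pos))

theorem hermiteTest_apply (e x : V) :
    hermiteTest e x = ((inner ℝ x e * Real.exp (-‖x‖ ^ 2) : ℝ) : ℂ) := by
  rw [hermiteTest, SchwartzMap.postcompCLM_apply, SchwartzMap.smulLeftCLM_apply_apply (by fun_prop)]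
  simp [gaussian_apply]

theorem hermite_mul_hermite_translate (e u x : V) :
    inner ℝ (u + (1 / 2 : ℝ) • x) e * Real.exp (-‖u + (1 / 2 : ℝ) • x‖ ^ 2) *
      (inner ℝ (u - (1 / 2 : ℝ) • x) e * Real.exp (-‖u - (1 / 2 : ℝ) • x‖ ^ 2)) =
    Real.exp (-(1 / 2 * ‖x‖ ^ 2)) * (inner ℝ u e ^ 2 * Real.exp (-(2 * ‖u‖ ^ 2))) -
      Real.exp (-(1 / 2 * ‖x‖ ^ 2)) * (inner ℝ x e ^ 2 / 4) * Real.exp (-(2 * ‖u‖ ^ 2)) := by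
  have hexp : Real.exp (-‖u + (1 / 2 : ℝ) • x‖ ^ 2) * Real.exp (-‖u - (1 / 2 : ℝ) • x‖ ^ 2) =
      Real.exp (-(1 / 2 * ‖x‖ ^ 2)) * Real.exp (-(2 * ‖u‖ ^ 2)) := by
    rw [← Real.exp_add, ← Real.exp_add, norm_add_sq_real, norm_sub_sq_real, norm_smul]
    norm_num
    ring
  rw [inner_add_left, inner_sub_left, inner_smul_left]
  simp only [conj_trivial]
  linear_combination (inner ℝ u e + 1 / 2 * inner ℝ x e) *
    (inner ℝ u e - 1 / 2 * inner ℝ x e) * hexp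

variable [FiniteDimensional ℝ V] [MeasurableSpace V] [BorelSpace V]

theorem integrable_gaussian {b : ℝ} (hb : 0 < b) :
    Integrable fun x : V => Real.exp (-(b * ‖x‖ ^ 2)) :=
  (gaussian V b hb).integrable

theorem integrable_inner_pow_mul_gaussian {b : ℝ} (hb : 0 < b) (e : V) (q : ℕ) :
    Integrable fun x : V => inner ℝ x e ^ q * Real.exp (-(b * ‖x‖ ^ 2)) := by
  refine (SchwartzMap.smulLeftCLM ℝ (fun x : V => inner ℝ x e ^ q)
    (gaussian V b hb)).integrable.congr (.of_forall fun x => ?_)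
  change SchwartzMap.smulLeftCLM ℝ (fun x : V => inner ℝ x e ^ q) (gaussian V b hb) x = _
  rw [SchwartzMap.smulLeftCLM_apply_apply (by fun_prop), gaussian_apply, smul_eq_mul]

theorem integral_inner_sq_mul_gaussian {b : ℝ} (hb : 0 < b) (e : V) :
    ∫ x : V, inner ℝ x e ^ 2 * Real.exp (-(b * ‖x‖ ^ 2)) =
      ‖e‖ ^ 2 / (2 * b) * ∫ x : V, Real.exp (-(b * ‖x‖ ^ 2)) := by
  have hderiv (x : V) : fderiv ℝ (fun x : V => Real.exp (-(b * ‖x‖ ^ 2))) x e =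
      -(2 * b) * (inner ℝ x e * Real.exp (-(b * ‖x‖ ^ 2))) := by
    rw [(hasFDerivAt_gaussian b x).fderiv]
    simp only [smul_apply, innerSL_apply_apply, smul_eq_mul]
    ring
  have hlin (x : V) : fderiv ℝ (fun x : V => inner ℝ x e) x e = ‖e‖ ^ 2 := by
    simp [fderiv_inner_apply (𝕜 := ℝ) differentiableAt_fun_id (differentiableAt_const e)]
  have hdiff (x : V) : inner ℝ x e * fderiv ℝ (fun x : V => Real.exp (-(b * ‖x‖ ^ 2))) x e =
      -(2 * b) * (inner ℝ x e ^ 2 * Real.exp (-(b * ‖x‖ ^ 2))) := by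
    rw [hderiv]
    ring
  have hparts := integral_mul_fderiv_eq_neg_fderiv_mul_of_integrable (μ := (volume : Measure V))
    (f := fun x : V => inner ℝ x e) (g := fun x : V => Real.exp (-(b * ‖x‖ ^ 2))) (v := e)
    (by simpa only [hlin] using (integrable_gaussian hb).const_mul _)
    (by simpa only [hdiff] using (integrable_inner_pow_mul_gaussian hb e 2).const_mul _)
    (by simpa only [pow_one] using integrable_inner_pow_mul_gaussian hb e 1)
    (fun x _ => differentiableAt_id.inner ℝ (differentiableAt_const e))
    (fun x _ => (hasFDerivAt_gaussian b x).differentiableAt)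
  simp only [hdiff, hlin, integral_const_mul] at hparts
  field_simp
  linarith

theorem autoConv_hermiteTest {e : V} (he : ‖e‖ = 1) (x : V) :
    autoConv (hermiteTest e) x = (((∫ u : V, Real.exp (-(2 * ‖u‖ ^ 2))) / 4 *
      ((1 - inner ℝ x e ^ 2) * Real.exp (-(1 / 2 * ‖x‖ ^ 2))) : ℝ) : ℂ) := by
  have hsub (u : V) : -(x - (u + (1 / 2 : ℝ) • x)) = u - (1 / 2 : ℝ) • x := by module
  rw [autoConv_apply]
  simp only [hermiteTest_apply, Complex.conj_ofReal, ← Complex.ofReal_mul]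
  rw [integral_complex_ofReal, ← integral_add_right_eq_self _ ((1 / 2 : ℝ) • x)]
  simp only [hsub, hermite_mul_hermite_translate]
  rw [integral_sub ((integrable_inner_pow_mul_gaussian two_pos e 2).const_mul _)
    ((integrable_gaussian two_pos).const_mul _), integral_const_mul, integral_const_mul,
    integral_inner_sq_mul_gaussian two_pos, he]
  congr 1
  ring

/-- The `q`-th moment of the half-line Gaussian `exp (-b r²)`. -/
def radialMoment (b : ℝ) (q : ℕ) : ℝ :=
  ∫ r in Set.Ioi (0 : ℝ), r ^ q * Real.exp (-(b * r ^ 2))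

theorem integrableOn_pow_mul_gaussian {b : ℝ} (hb : 0 < b) (q : ℕ) :
    IntegrableOn (fun r : ℝ => r ^ q * Real.exp (-(b * r ^ 2))) (Set.Ioi 0) := by
  simpa using (integrable_rpow_mul_exp_neg_mul_sq hb (s := q)
    (by linarith [q.cast_nonneg (α := ℝ)])).integrableOn (s := Set.Ioi 0)

theorem radialMoment_eq_gamma {b : ℝ} (hb : 0 < b) (q : ℕ) : radialMoment b q =
    b ^ (-(q + 1 : ℝ) / 2) * (1 / 2) * Real.Gamma ((q + 1) / 2) := by
  rw [← integral_rpow_mul_exp_neg_mul_rpow two_pos (by linarith [q.cast_nonneg (α := ℝ)]) hb]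
  simp [radialMoment]

theorem radialMoment_pos {b : ℝ} (hb : 0 < b) (q : ℕ) : 0 < radialMoment b q := by
  rw [radialMoment_eq_gamma hb]
  exact mul_pos (by positivity) (Real.Gamma_pos_of_pos (by positivity))

theorem radialMoment_add_two {b : ℝ} (hb : 0 < b) (q : ℕ) :
    radialMoment b (q + 2) = (q + 1) / (2 * b) * radialMoment b q := by
  rw [radialMoment_eq_gamma hb, radialMoment_eq_gamma hb]
  have hhalf : (((q + 2 : ℕ) : ℝ) + 1) / 2 = ((q : ℝ) + 1) / 2 + 1 := by
    push_cast
    ring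
  have hneg_half : -(((q + 2 : ℕ) : ℝ) + 1) / 2 = -((q : ℝ) + 1) / 2 - 1 := by
    push_cast
    ring
  rw [hhalf, hneg_half, Real.Gamma_add_one (by positivity), Real.rpow_sub_one hb.ne']
  field_simp

theorem integral_radial_one_sub_sq_mul_gaussian (d : ℕ) (a : ℝ) :
    ∫ r in Set.Ioi (0 : ℝ), r ^ d * ((1 - r ^ 2 * a) * Real.exp (-(1 / 2 * r ^ 2))) =
      radialMoment (1 / 2) d * (1 - (d + 1) * a) := by
  have hexpand (r : ℝ) : r ^ d * ((1 - r ^ 2 * a) * Real.exp (-(1 / 2 * r ^ 2))) =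
      r ^ d * Real.exp (-(1 / 2 * r ^ 2)) -
        a * (r ^ (d + 2) * Real.exp (-(1 / 2 * r ^ 2))) := by ring
  simp only [hexpand]
  rw [integral_sub (integrableOn_pow_mul_gaussian one_half_pos d)
    ((integrableOn_pow_mul_gaussian one_half_pos (d + 2)).const_mul _), integral_const_mul]
  change radialMoment (1 / 2) d - a * radialMoment (1 / 2) (d + 2) = _
  rw [radialMoment_add_two one_half_pos]
  ring

theorem integral_mul_one_sub_inner_sq_mul_gaussian {f : V → ℝ} {q : ℕ}
    (hq : q < Module.finrank ℝ V)
    (hhom : ∀ r : ℝ, 0 < r → ∀ x, f (r • x) = (r ^ q)⁻¹ * f x) (e : V)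
    (hf : Integrable fun x => f x * ((1 - inner ℝ x e ^ 2) * Real.exp (-(1 / 2 * ‖x‖ ^ 2)))) :
    ∫ x, f x * ((1 - inner ℝ x e ^ 2) * Real.exp (-(1 / 2 * ‖x‖ ^ 2))) =
      radialMoment (1 / 2) (Module.finrank ℝ V - q - 1) * ∫ θ : Metric.sphere (0 : V) 1,
        f θ * (1 - (Module.finrank ℝ V - q : ℕ) * inner ℝ (θ : V) e ^ 2) ∂sphereMeasure V := by
  have : Nontrivial V := Module.nontrivial_of_finrank_pos (R := ℝ) (by omega)
  obtain ⟨d, hd⟩ : ∃ d, Module.finrank ℝ V = d + 1 + q := ⟨Module.finrank ℝ V - q - 1, by omega⟩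
  rw [integral_eq_integral_toSphere hf, ← integral_const_mul]
  refine integral_congr_ae (.of_forall fun θ => ?_)
  have hray : ∀ r ∈ Set.Ioi (0 : ℝ), r ^ (Module.finrank ℝ V - 1) • (f (r • (θ : V)) *
      ((1 - inner ℝ (r • (θ : V)) e ^ 2) * Real.exp (-(1 / 2 * ‖r • (θ : V)‖ ^ 2)))) =
      f θ * (r ^ d * ((1 - r ^ 2 * inner ℝ (θ : V) e ^ 2) * Real.exp (-(1 / 2 * r ^ 2)))) := by
    intro r hr
    have hr0 : r ≠ 0 := (Set.mem_Ioi.1 hr).ne'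
    have hpow : r ^ (Module.finrank ℝ V - 1) * (r ^ q)⁻¹ = r ^ d := by
      rw [show Module.finrank ℝ V - 1 = d + q by omega, pow_add,
        mul_inv_cancel_right₀ (pow_ne_zero q hr0)]
    rw [hhom r hr, real_inner_smul_left, mul_pow, norm_smul, norm_eq_of_mem_sphere, mul_one,
      Real.norm_eq_abs, sq_abs, smul_eq_mul, ← hpow]
    ring
  dsimp only
  rw [setIntegral_congr_fun measurableSet_Ioi hray, integral_const_mul,
    integral_radial_one_sub_sq_mul_gaussian, show Module.finrank ℝ V - q = d + 1 by omega]
  push_cast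
  ring

theorem moment_nonneg_of_isPositiveDefiniteDistribution {f : V → ℝ} {q : ℕ}
    (hf : IsPositiveDefiniteDistribution f) (hq : q < Module.finrank ℝ V)
    (hhom : ∀ r : ℝ, 0 < r → ∀ x, f (r • x) = (r ^ q)⁻¹ * f x) {e : V} (he : ‖e‖ = 1) :
    0 ≤ ∫ θ : Metric.sphere (0 : V) 1,
      f θ * (1 - (Module.finrank ℝ V - q : ℕ) * inner ℝ (θ : V) e ^ 2) ∂sphereMeasure V := by
  obtain ⟨T, hT, hpd⟩ := hf
  have hnonneg := (hpd (hermiteTest e)).1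
  obtain ⟨hint, hval⟩ := hT (autoConv (hermiteTest e))
  set B := ∫ u : V, Real.exp (-(2 * ‖u‖ ^ 2))
  have hB : 0 < B / 4 := div_pos (integral_exp_pos (integrable_gaussian two_pos)) four_pos
  have htest (x : V) : (f x : ℂ) * autoConv (hermiteTest e) x =
      ((B / 4 * (f x * ((1 - inner ℝ x e ^ 2) * Real.exp (-(1 / 2 * ‖x‖ ^ 2)))) : ℝ) : ℂ) := by
    rw [autoConv_hermiteTest he]
    push_cast
    ring
  simp only [htest] at hint hval
  have hint_real : Integrable fun x =>
      f x * ((1 - inner ℝ x e ^ 2) * Real.exp (-(1 / 2 * ‖x‖ ^ 2))) :=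
    (integrable_const_mul_iff hB.ne'.isUnit _).1 hint.re
  rw [hval, integral_complex_ofReal, Complex.ofReal_re, integral_const_mul,
    integral_mul_one_sub_inner_sq_mul_gaussian hq hhom e hint_real] at hnonneg
  exact nonneg_of_mul_nonneg_right (nonneg_of_mul_nonneg_right hnonneg hB)
    (radialMoment_pos one_half_pos _)

end Gaussian

section NotPositiveDefinite

theorem exists_not_isPositiveDefiniteDistribution {n : ℕ} (hn : 3 ≤ n) :
    ∃ K : ConvexBody (RSpace n), IsAdmissible K ∧
      ¬ IsPositiveDefiniteDistribution (bpFunction (K : Set (RSpace n))) := by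
  obtain ⟨m, rfl⟩ : ∃ m, n = m + 1 := ⟨n - 1, by omega⟩
  obtain ⟨-, L, -, hL, -, hpos⟩ :=
    exists_isAdmissible_pow_eq_add_axialExcess (by omega : 2 ≤ m) (0 : Fin (m + 1))
  refine ⟨L, hL, fun hpd => hpos.not_ge ?_⟩
  have hcont := hL.continuous_bpFunction_sphere
  have hmoment (i : Fin 2) : 0 ≤ ∫ θ : Metric.sphere (0 : RSpace (m + 1)) 1,
      bpFunction (L : Set (RSpace (m + 1))) θ * (1 - 2 * m * (θ : RSpace (m + 1)) (0, i) ^ 2)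
        ∂sphereMeasure (RSpace (m + 1)) := by
    have hfinrank : Module.finrank ℝ (RSpace (m + 1)) = 2 * (m + 1) := finrank_RSpace (m + 1)
    have hnonneg := moment_nonneg_of_isPositiveDefiniteDistribution hpd (by omega)
      (fun r hr x => bpFunction_smul _ hr x) (e := EuclideanSpace.single (0, i) (1 : ℝ)) (by simp)
    rw [show Module.finrank ℝ (RSpace (m + 1)) - 2 = 2 * m by omega] at hnonneg
    simpa [EuclideanSpace.inner_single_right] using hnonneg
  have hsum := add_nonneg (hmoment 0) (hmoment 1)
  rw [← integral_add (integrable_of_continuous (by fun_prop))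
    (integrable_of_continuous (by fun_prop))] at hsum
  have hexcess (θ : RSpace (m + 1)) :
      bpFunction (L : Set (RSpace (m + 1))) θ * (1 - 2 * m * θ (0, 0) ^ 2) +
        bpFunction (L : Set (RSpace (m + 1))) θ * (1 - 2 * m * θ (0, 1) ^ 2) =
      -2 * (bpFunction (L : Set (RSpace (m + 1))) θ * axialExcess m 0 θ) := by
    rw [axialExcess, norm_sq_coordMap]
    ring
  simp only [hexcess, integral_const_mul] at hsum
  linarith

end NotPositiveDefinite

section Rotation

variable {n : ℕ}

theorem perp_add (x y : RSpace n) : perp (x + y) = perp x + perp y := by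
  ext ⟨k, i⟩
  fin_cases i
  · simp [perp, add_comm]
  · simp [perp]

theorem perp_smul (r : ℝ) (x : RSpace n) : perp (r • x) = r • perp x := by
  ext ⟨k, i⟩
  fin_cases i <;> simp [perp]

theorem continuous_perp : Continuous (perp : RSpace n → RSpace n) :=
  (IsLinearMap.mk' perp ⟨perp_add, perp_smul⟩).continuous_of_finiteDimensional

/-- Multiplication of a point of `ℝ²ⁿ = ℂⁿ` by a complex scalar. -/
def cmul (z : ℂ) (x : RSpace n) : RSpace n := z.re • x + z.im • perp x

theorem rot_eq_cmul (t : ℝ) (x : RSpace n) :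
    rot t x = cmul (Complex.exp (t * Complex.I)) x := by
  ext ⟨k, i⟩
  fin_cases i <;>
    simp [rot, cmul, perp, Complex.exp_ofReal_mul_I_re, Complex.exp_ofReal_mul_I_im] <;> ring

theorem norm_cmul (z : ℂ) (x : RSpace n) : ‖cmul z x‖ = ‖z‖ * ‖x‖ := by
  have hinner : inner ℝ (z.re • x) (z.im • perp x) = 0 := by
    rw [real_inner_smul_left, real_inner_smul_right, inner_perp, mul_zero, mul_zero]
  rw [← sq_eq_sq₀ (norm_nonneg _) (by positivity), cmul, norm_add_sq_real, hinner, norm_smul,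
    norm_smul, norm_perp, mul_pow, mul_pow, mul_pow, Complex.sq_norm, Complex.normSq_apply,
    Real.norm_eq_abs, Real.norm_eq_abs, sq_abs, sq_abs]
  ring

theorem cmul_smul (r : ℝ) (z : ℂ) (x : RSpace n) : cmul (r • z) x = r • cmul z x := by
  simp [cmul, smul_smul]

theorem continuous_cmul : Continuous fun p : ℂ × RSpace n => cmul p.1 p.2 := by
  have hperp := continuous_perp (n := n)
  unfold cmul
  fun_prop

/-- The complex line through the unit vector `x`, parametrized isometrically by `z ↦ z x`. -/
def complexLine (x : RSpace n) (hx : ‖x‖ = 1) : ℂ →ₗᵢ[ℝ] RSpace n where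
  toFun z := cmul z x
  map_add' z w := by
    simp only [cmul, Complex.add_re, Complex.add_im]
    module
  map_smul' r z := cmul_smul r z x
  norm_map' z := by
    change ‖cmul z x‖ = ‖z‖
    rw [norm_cmul, hx, mul_one]

/-- Multiplication by a complex number of modulus one, as an isometry. -/
def cmulIsometry (u : ℂ) (hu : ‖u‖ = 1) : RSpace n ≃ₗᵢ[ℝ] RSpace n :=
  LinearIsometry.toLinearIsometryEquiv
    { toFun := cmul u
      map_add' := fun x y => by
        simp only [cmul, perp_add]
        module
      map_smul' := fun r x => by
        simp only [cmul, perp_smul, RingHom.id_apply]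
        module
      norm_map' := fun x => by
        change ‖cmul u x‖ = ‖x‖
        rw [norm_cmul, hu, one_mul] } rfl

theorem exists_mem_Icc_exp_mul_I_eq {u : ℂ} (hu : ‖u‖ = 1) :
    ∃ t ∈ Set.Icc (0 : ℝ) (2 * Real.pi), Complex.exp (t * Complex.I) = u := by
  obtain ⟨t, ht, hexp⟩ := Circle.periodic_exp.exists_mem_Ico₀ Real.two_pi_pos u.arg
  refine ⟨t, Set.Ico_subset_Icc_self ht, ?_⟩
  rw [← Circle.coe_exp, ← hexp, Circle.coe_exp]
  simpa [hu] using Complex.norm_mul_exp_arg_mul_I u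

variable {K : ConvexBody (RSpace n)}

theorem IsAdmissible.gauge_cmul (hK : IsAdmissible K) {u : ℂ} (hu : ‖u‖ = 1) (x : RSpace n) :
    gauge (K : Set (RSpace n)) (cmul u x) = gauge (K : Set (RSpace n)) x := by
  obtain ⟨t, ht, rfl⟩ := exists_mem_Icc_exp_mul_I_eq hu
  rw [← rot_eq_cmul, hK.rotInvariant t ht]

theorem IsAdmissible.bpFunction_cmul (hK : IsAdmissible K) {u : ℂ} (hu : ‖u‖ = 1)
    (x : RSpace n) :
    bpFunction (K : Set (RSpace n)) (cmul u x) = bpFunction (K : Set (RSpace n)) x := by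
  rw [bpFunction, bpFunction, hK.gauge_cmul hu, norm_cmul, hu, one_mul]

end Rotation

section TwoDimensional

theorem toComplex_perp {n : ℕ} (x : RSpace n) (k : Fin n) :
    toComplex (perp x) k = Complex.I * toComplex x k := by
  apply Complex.ext <;> simp [toComplex, perp]

theorem perp_mem_hyperplane {n : ℕ} {ξ η : RSpace n} (hη : η ∈ hyperplane ξ) :
    perp η ∈ hyperplane ξ := by
  rw [mem_hyperplane_iff] at hη ⊢
  simp only [toComplex_perp, mul_assoc, ← Finset.mul_sum, hη, mul_zero]

theorem exists_mem_hyperplane {η : RSpace 2} (hη : ‖η‖ = 1) :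
    ∃ ξ : RSpace 2, ‖ξ‖ = 1 ∧ η ∈ hyperplane ξ := by
  -- In complex notation `ξ = (-conj η₂, conj η₁)`.
  let ξ : RSpace 2 := WithLp.toLp 2 fun p => match p with
    | (0, 0) => -η (1, 0)
    | (0, 1) => η (1, 1)
    | (1, 0) => η (0, 0)
    | (1, 1) => -η (0, 1)
  refine ⟨ξ, ?_, ?_⟩
  · rw [← hη, ← sq_eq_sq₀ (norm_nonneg _) (norm_nonneg _), norm_sq_eq, norm_sq_eq]
    simp only [Fin.sum_univ_two, ξ]
    ring
  · rw [mem_hyperplane_iff]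
    apply Complex.ext <;> simp [Fin.sum_univ_two, ξ, toComplex] <;> ring

theorem span_perp_eq_hyperplane {ξ η : RSpace 2} (hξ : ‖ξ‖ = 1) (hη : ‖η‖ = 1)
    (hηξ : η ∈ hyperplane ξ) : Submodule.span ℝ {η, perp η} = hyperplane ξ := by
  refine Submodule.eq_of_le_of_finrank_eq (Submodule.span_le.2 ?_) ?_
  · rintro _ (rfl | rfl)
    exacts [hηξ, perp_mem_hyperplane hηξ]
  · rw [finrank_span_perp hη, finrank_hyperplane hξ]

theorem exists_eq_cmul_of_mem_hyperplane {ξ η x : RSpace 2} (hξ : ‖ξ‖ = 1) (hη : ‖η‖ = 1)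
    (hηξ : η ∈ hyperplane ξ) (hx : x ∈ hyperplane ξ) : ∃ z : ℂ, x = cmul z η := by
  rw [← span_perp_eq_hyperplane hξ hη hηξ] at hx
  obtain ⟨a, b, rfl⟩ := Submodule.mem_span_pair.1 hx
  exact ⟨⟨a, b⟩, rfl⟩

variable {K L : ConvexBody (RSpace 2)}

theorem IsAdmissible.bpFunction_eq_of_mem_hyperplane (hK : IsAdmissible K) {ξ η x : RSpace 2}
    (hξ : ‖ξ‖ = 1) (hη : ‖η‖ = 1) (hx : ‖x‖ = 1) (hηξ : η ∈ hyperplane ξ)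
    (hxξ : x ∈ hyperplane ξ) :
    bpFunction (K : Set (RSpace 2)) x = bpFunction (K : Set (RSpace 2)) η := by
  obtain ⟨z, rfl⟩ := exists_eq_cmul_of_mem_hyperplane hξ hη hηξ hxξ
  rw [norm_cmul, hη, mul_one] at hx
  exact hK.bpFunction_cmul hx η

theorem IsAdmissible.hvolSection_two (hK : IsAdmissible K) {ξ η : RSpace 2}
    (hξ : ‖ξ‖ = 1) (hη : ‖η‖ = 1) (hηξ : η ∈ hyperplane ξ) :
    hvolSection (K : Set (RSpace 2)) ξ =
      ENNReal.ofReal (4 * ((sphereMeasure (hyperplane ξ)).real Set.univ *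
        bpFunction (K : Set (RSpace 2)) η)) := by
  have hconst (θ : Metric.sphere (0 : hyperplane ξ) 1) :
      bpFunction (K : Set (RSpace 2)) ((θ : hyperplane ξ) : RSpace 2) =
        bpFunction (K : Set (RSpace 2)) η :=
    hK.bpFunction_eq_of_mem_hyperplane hξ hη (norm_eq_of_mem_sphere θ) hηξ (θ : hyperplane ξ).2
  rw [hK.hvolSection_eq le_rfl hξ]
  simp only [hconst, integral_const, smul_eq_mul]
  norm_num

theorem bpFunction_le_of_hvolSection_le (hK : IsAdmissible K) (hL : IsAdmissible L)
    (hle : ∀ ξ : RSpace 2, ‖ξ‖ = 1 →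
      hvolSection (K : Set (RSpace 2)) ξ ≤ hvolSection (L : Set (RSpace 2)) ξ)
    {η : RSpace 2} (hη : ‖η‖ = 1) :
    bpFunction (K : Set (RSpace 2)) η ≤ bpFunction (L : Set (RSpace 2)) η := by
  obtain ⟨ξ, hξ, hηξ⟩ := exists_mem_hyperplane hη
  have : Nontrivial (hyperplane ξ) := nontrivial_hyperplane le_rfl hξ
  have hsection := hle ξ hξ
  rw [hK.hvolSection_two hξ hη hηξ, hL.hvolSection_two hξ hη hηξ, ENNReal.ofReal_le_ofReal_iff
    (mul_nonneg (by norm_num) (mul_nonneg measureReal_nonneg (hL.bpFunction_nonneg η)))] at hsection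
  exact le_of_mul_le_mul_left (le_of_mul_le_mul_left hsection four_pos) sphereMeasure_real_univ_pos

theorem busemannPettyAffirmative_two : BusemannPettyAffirmative 2 := by
  intro K L hK hL hle
  rw [hK.hvol_eq two_pos, hL.hvol_eq two_pos]
  refine ENNReal.ofReal_le_ofReal (mul_le_mul_of_nonneg_left ?_ (by positivity))
  exact integral_mono (integrable_of_continuous (hK.continuous_bpFunction_sphere.pow 2))
    (integrable_of_continuous (hL.continuous_bpFunction_sphere.pow 2)) fun θ =>
      pow_le_pow_left₀ (hK.bpFunction_nonneg θ)
        (bpFunction_le_of_hvolSection_le hK hL hle (norm_eq_of_mem_sphere θ)) 2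

end TwoDimensional

section SubspacePositivity

theorem exists_norm_le_inv_pow {V : Type*} [NormedAddCommGroup V] [NormedSpace ℝ V]
    (φ : 𝓢(V, ℂ)) (N : ℕ) : ∃ C, 0 ≤ C ∧ ∀ x, ‖φ x‖ ≤ C * ((1 + ‖x‖) ^ N)⁻¹ := by
  refine ⟨2 ^ N * (Finset.Iic (N, 0)).sup (schwartzSeminormFamily ℝ V ℂ) φ, by positivity,
    fun x => ?_⟩
  have hsup := SchwartzMap.one_add_le_sup_seminorm_apply (𝕜 := ℝ) (m := (N, 0)) le_rfl le_rfl φ x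
  rw [norm_iteratedFDeriv_zero] at hsup
  rwa [← div_eq_mul_inv, le_div_iff₀ (by positivity), mul_comm]

variable {V : Type*} [NormedAddCommGroup V] [InnerProductSpace ℝ V]

theorem norm_orthogonalProjectionOnto_sub_le (H : Submodule ℝ V)
    [H.HasOrthogonalProjection] (y : V) (h : H) :
    ‖H.orthogonalProjectionOnto y - h‖ ≤ ‖y - h‖ := by
  have hproj : H.orthogonalProjectionOnto y - h = H.orthogonalProjectionOnto (y - h) := by
    rw [map_sub, Submodule.orthogonalProjectionOnto_mem_subspace_eq_self]
  rw [hproj]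
  exact Submodule.norm_orthogonalProjectionOnto_apply_le _ _

theorem add_orthogonal_eq_comp (H : Submodule ℝ V) [H.HasOrthogonalProjection] :
    (fun p : H × Hᗮ => (p.1 : V) + p.2) = H.orthogonalDecomposition.symm ∘ WithLp.toLp 2 := by
  funext p
  simp

variable [FiniteDimensional ℝ V] [MeasurableSpace V] [BorelSpace V]

theorem integrable_inv_one_add_norm_pow :
    Integrable fun x : V => ((1 + ‖x‖) ^ (Module.finrank ℝ V + 1))⁻¹ := by
  have hint := integrable_one_add_norm (E := V) (μ := volume)
    (r := (Module.finrank ℝ V + 1 : ℕ)) (by push_cast; linarith)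
  refine hint.congr (Filter.Eventually.of_forall fun x => ?_)
  dsimp only
  rw [Real.rpow_neg (by positivity), Real.rpow_natCast]

theorem measurePreserving_add_orthogonal (H : Submodule ℝ V) :
    MeasurePreserving (fun p : H × Hᗮ => (p.1 : V) + p.2) (volume.prod volume) volume := by
  rw [add_orthogonal_eq_comp]
  exact H.orthogonalDecomposition.symm.measurePreserving.comp
    (WithLp.volume_preserving_toLp H Hᗮ)

theorem measurableEmbedding_add_orthogonal (H : Submodule ℝ V) :
    MeasurableEmbedding fun p : H × Hᗮ => (p.1 : V) + p.2 := by
  refine Continuous.measurableEmbedding (by fun_prop) ?_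
  rw [add_orthogonal_eq_comp]
  exact H.orthogonalDecomposition.symm.injective.comp (WithLp.toLp_injective 2)

theorem integrable_mul_comp_sub {E F : Type*} [NormedAddCommGroup E] [MeasurableSpace E]
    [BorelSpace E] [SecondCountableTopology E] [TopologicalSpace F] [MeasurableSpace F]
    [BorelSpace F] [SecondCountableTopology F] {μ : Measure E} [μ.IsAddLeftInvariant]
    [μ.IsNegInvariant] [SigmaFinite μ] {ν : Measure F} [SigmaFinite ν] {a : E → ℝ}
    {b : F → ℝ} {P : F → E} (hac : Continuous a) (ha : Integrable a μ) (hbc : Continuous b)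
    (hb : Integrable b ν) (hP : Continuous P) :
    Integrable (fun q : E × F => b q.2 * a (P q.2 - q.1)) (μ.prod ν) := by
  rw [integrable_prod_iff' (Continuous.aestronglyMeasurable (by fun_prop))]
  refine ⟨Filter.Eventually.of_forall fun y => (ha.comp_sub_left (P y)).const_mul (b y), ?_⟩
  have hinner : ∀ y, ∫ h, ‖b y * a (P y - h)‖ ∂μ = ‖b y‖ * ∫ h, ‖a h‖ ∂μ := by
    intro y
    simp only [norm_mul]
    rw [integral_const_mul, integral_sub_left_eq_self (fun h => ‖a h‖) μ (P y)]
  simp only [hinner]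
  exact hb.norm.mul_const _

theorem integrable_mul_conj_sub (φ : 𝓢(V, ℂ)) (H : Submodule ℝ V) :
    Integrable (fun q : H × V => φ q.2 * conj (φ (q.2 - q.1))) (volume.prod volume) := by
  have hφc := φ.continuous
  let decay : H → ℝ := fun h => ((1 + ‖h‖) ^ (Module.finrank ℝ H + 1))⁻¹
  have hdecay : Continuous decay :=
    Continuous.inv₀ (by fun_prop) fun h => by positivity
  obtain ⟨C, hC, hφ⟩ := exists_norm_le_inv_pow φ (Module.finrank ℝ H + 1)
  have hmajorant := integrable_mul_comp_sub (P := fun y => H.orthogonalProjectionOnto y)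
    hdecay integrable_inv_one_add_norm_pow hφc.norm (φ.integrable (μ := volume)).norm (by fun_prop)
  refine (hmajorant.const_mul C).mono' (Continuous.aestronglyMeasurable (by fun_prop))
    (Filter.Eventually.of_forall fun ⟨h, y⟩ => ?_)
  have hle : ‖φ (y - h)‖ ≤ C * decay (H.orthogonalProjectionOnto y - h) := by
    refine (hφ _).trans (mul_le_mul_of_nonneg_left ?_ hC)
    have hproj := norm_orthogonalProjectionOnto_sub_le H y h
    simp only [decay]
    gcongr
  calc ‖φ y * conj (φ (y - h))‖ = ‖φ y‖ * ‖φ (y - h)‖ := by rw [norm_mul, RCLike.norm_conj]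
    _ ≤ ‖φ y‖ * (C * decay (H.orthogonalProjectionOnto y - h)) := by gcongr
    _ = C * (‖φ y‖ * decay (H.orthogonalProjectionOnto y - h)) := by ring

theorem integral_mul_conj_sub_coset (φ : V → ℂ) (H : Submodule ℝ V) (k : H) (w : V) :
    ∫ h : H, φ (k + w) * conj (φ (k + w - h)) = φ (k + w) * conj (∫ h : H, φ (h + w)) := by
  rw [integral_const_mul, integral_conj,
    ← integral_sub_left_eq_self (fun h : H => φ (h + w)) volume k]
  congr 3
  funext h
  rw [Submodule.coe_sub, sub_add_eq_add_sub]

theorem integrable_mul_conj_integral_coset (φ : 𝓢(V, ℂ)) (H : Submodule ℝ V) :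
    Integrable (fun p : H × Hᗮ => φ (p.1 + p.2) * conj (∫ h : H, φ (h + p.2)))
      (volume.prod volume) := by
  have hV : Integrable fun y => ∫ h : H, φ y * conj (φ (y - h)) :=
    (integrable_mul_conj_sub φ H).integral_prod_right
  refine (((measurePreserving_add_orthogonal H).integrable_comp_emb
    (measurableEmbedding_add_orthogonal H)).2 hV).congr (Filter.Eventually.of_forall fun p => ?_)
  exact integral_mul_conj_sub_coset φ H p.1 p.2

theorem integral_autoConv_submodule (φ : 𝓢(V, ℂ)) (H : Submodule ℝ V) :
    ∫ h : H, autoConv φ h = ((∫ w : Hᗮ, ‖∫ h : H, φ (h + w)‖ ^ 2 : ℝ) : ℂ) :=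
  calc ∫ h : H, autoConv φ h = ∫ h : H, ∫ y, φ y * conj (φ (y - h)) := by
        simp only [autoConv_apply, neg_sub]
    _ = ∫ y, ∫ h : H, φ y * conj (φ (y - h)) :=
        integral_integral_swap (integrable_mul_conj_sub φ H)
    _ = ∫ p : H × Hᗮ, (∫ h : H, φ (p.1 + p.2) * conj (φ (p.1 + p.2 - h)))
          ∂(volume.prod volume) :=
        ((measurePreserving_add_orthogonal H).integral_comp
          (measurableEmbedding_add_orthogonal H)
          (fun y => ∫ h : H, φ y * conj (φ (y - h)))).symm
    _ = ∫ p : H × Hᗮ, φ (p.1 + p.2) * conj (∫ h : H, φ (h + p.2)) ∂(volume.prod volume) := by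
        simp only [integral_mul_conj_sub_coset]
    _ = ∫ w : Hᗮ, ∫ k : H, φ (k + w) * conj (∫ h : H, φ (h + w)) :=
        integral_prod_symm _ (integrable_mul_conj_integral_coset φ H)
    _ = ∫ w : Hᗮ, ((‖∫ h : H, φ (h + w)‖ ^ 2 : ℝ) : ℂ) := by
        simp only [integral_mul_const, Complex.mul_conj, Complex.normSq_eq_norm_sq]
    _ = ((∫ w : Hᗮ, ‖∫ h : H, φ (h + w)‖ ^ 2 : ℝ) : ℂ) := integral_complex_ofReal

theorem exists_nonneg_integral_autoConv_eq {E : Type*} [NormedAddCommGroup E]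
    [InnerProductSpace ℝ E] [FiniteDimensional ℝ E] [MeasurableSpace E] [BorelSpace E]
    (φ : 𝓢(V, ℂ)) (ι : E →ₗᵢ[ℝ] V) :
    ∃ j : ℝ, 0 ≤ j ∧ ∫ z, autoConv φ (ι z) = (j : ℂ) := by
  let H := LinearMap.range ι.toLinearMap
  refine ⟨∫ w : Hᗮ, ‖∫ h : H, φ (h + w)‖ ^ 2, integral_nonneg fun _ => sq_nonneg _, ?_⟩
  rw [← integral_autoConv_submodule φ H]
  exact ι.equivRange.measurePreserving.integral_comp
    ι.equivRange.toHomeomorph.measurableEmbedding (fun h : H => autoConv φ h)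

end SubspacePositivity

section RayIntegral

variable {V : Type*} [NormedAddCommGroup V] [NormedSpace ℝ V]

theorem pow_mul_inv_one_add_pow_le (k : ℕ) {r : ℝ} (hr : 0 ≤ r) :
    r ^ k * ((1 + r) ^ (k + 2))⁻¹ ≤ (1 + r ^ 2)⁻¹ := by
  rw [← div_eq_mul_inv, div_le_iff₀ (by positivity), ← div_eq_inv_mul,
    le_div_iff₀ (by positivity), pow_add]
  have hpow : r ^ k ≤ (1 + r) ^ k := by gcongr; linarith
  have hsq : 1 + r ^ 2 ≤ (1 + r) ^ 2 := by nlinarith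
  gcongr

/-- The integral of `ψ` along the ray through `x` against the density `r dr`, that is, the
polar-coordinate density of a plane. -/
def rayIntegral (ψ : 𝓢(V, ℂ)) (x : V) : ℂ := ∫ r in Set.Ioi (0 : ℝ), r • ψ (r • x)

theorem exists_norm_smul_apply_smul_le (ψ : 𝓢(V, ℂ)) :
    ∃ C, ∀ x : V, ‖x‖ = 1 → ∀ r : ℝ, 0 < r → ‖r • ψ (r • x)‖ ≤ C * (1 + r ^ 2)⁻¹ := by
  obtain ⟨C, hC, hψ⟩ := exists_norm_le_inv_pow ψ 3
  refine ⟨C, fun x hx r hr => ?_⟩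
  have hdecay := hψ (r • x)
  rw [norm_smul, hx, mul_one, Real.norm_of_nonneg hr.le] at hdecay
  calc ‖r • ψ (r • x)‖ = r * ‖ψ (r • x)‖ := by rw [norm_smul, Real.norm_of_nonneg hr.le]
    _ ≤ r * (C * ((1 + r) ^ 3)⁻¹) := by gcongr
    _ = C * (r ^ 1 * ((1 + r) ^ 3)⁻¹) := by ring
    _ ≤ C * (1 + r ^ 2)⁻¹ :=
        mul_le_mul_of_nonneg_left (pow_mul_inv_one_add_pow_le 1 hr.le) hC

theorem continuous_rayIntegral {X : Type*} [TopologicalSpace X] [FirstCountableTopology X]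
    (ψ : 𝓢(V, ℂ)) {g : X → V} (hg : Continuous g) (hg1 : ∀ x, ‖g x‖ = 1) :
    Continuous fun x => rayIntegral ψ (g x) := by
  obtain ⟨C, hC⟩ := exists_norm_smul_apply_smul_le ψ
  have hψ := ψ.continuous
  unfold rayIntegral
  refine continuous_of_dominated (bound := fun r => C * (1 + r ^ 2)⁻¹)
    (fun x => Continuous.aestronglyMeasurable (by fun_prop)) (fun x => ?_)
    (integrable_inv_one_add_sq.const_mul C).integrableOn
    (Filter.Eventually.of_forall fun r => by fun_prop)
  filter_upwards [ae_restrict_mem measurableSet_Ioi] with r hr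
  exact hC _ (hg1 x) r hr

end RayIntegral

section TemperedDistribution

variable {n : ℕ} {K : ConvexBody (RSpace n)}

theorem IsAdmissible.measurable_bpFunction (hK : IsAdmissible K) :
    Measurable (bpFunction (K : Set (RSpace n))) := by
  have hgauge := hK.continuous_gauge.measurable
  unfold bpFunction
  fun_prop

theorem IsAdmissible.exists_bpFunction_le (hK : IsAdmissible K) :
    ∃ C, ∀ x, bpFunction (K : Set (RSpace n)) x ≤ C * (‖x‖ ^ 2)⁻¹ := by
  obtain ⟨C, hC⟩ := isCompact_univ.exists_bound_of_continuousOn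
    hK.continuous_bpFunction_sphere.continuousOn
  refine ⟨C, fun x => ?_⟩
  by_cases hx : x = 0
  · simp [hx, bpFunction]
  have hx0 : 0 < ‖x‖ := norm_pos_iff.2 hx
  have hunit : bpFunction (K : Set (RSpace n)) (‖x‖⁻¹ • x) ≤ C :=
    (le_abs_self _).trans (hC ⟨‖x‖⁻¹ • x, by simp [norm_smul, hx0.ne']⟩ (Set.mem_univ _))
  calc bpFunction (K : Set (RSpace n)) x
      = bpFunction (K : Set (RSpace n)) (‖x‖⁻¹ • x) * (‖x‖ ^ 2)⁻¹ := by
        rw [mul_comm, ← bpFunction_smul _ hx0, smul_smul, mul_inv_cancel₀ hx0.ne', one_smul]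
    _ ≤ C * (‖x‖ ^ 2)⁻¹ := by gcongr

theorem exists_represents_of_integrable_mul_inv_pow {V : Type*} [NormedAddCommGroup V]
    [InnerProductSpace ℝ V] [FiniteDimensional ℝ V] [MeasurableSpace V] [BorelSpace V]
    {f : V → ℝ} (hf : Measurable f) (hf0 : ∀ x, 0 ≤ f x) {N : ℕ}
    (hfi : Integrable fun x => f x * ((1 + ‖x‖) ^ N)⁻¹) :
    ∃ T : 𝓢'(V, ℂ), Represents f T := by
  have hm : Measurable fun x => (f x).toNNReal := hf.real_toNNReal
  have hcoe : ∀ x, ((f x).toNNReal : ℝ) = f x := fun x => Real.coe_toNNReal _ (hf0 x)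
  let μ : Measure V := volume.withDensity fun x => ((f x).toNNReal : ENNReal)
  have hμ : μ.HasTemperateGrowth := by
    refine ⟨⟨N, ?_⟩⟩
    rw [integrable_withDensity_iff_integrable_smul hm]
    refine hfi.congr (Filter.Eventually.of_forall fun x => ?_)
    dsimp only
    rw [NNReal.smul_def, hcoe, smul_eq_mul, Real.rpow_neg (by positivity), Real.rpow_natCast]
  refine ⟨μ.toTemperedDistribution, fun φ => ?_⟩
  have hsmul : (fun x => (f x : ℂ) * φ x) = fun x => (f x).toNNReal • φ x := by
    funext x
    rw [NNReal.smul_def, hcoe, Complex.real_smul]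
  rw [hsmul, ← integrable_withDensity_iff_integrable_smul hm,
    Measure.toTemperedDistribution_apply μ, integral_withDensity_eq_integral_smul hm]
  exact ⟨φ.integrable, rfl⟩

theorem integrable_inv_norm_sq_mul_inv_one_add_norm_pow {V : Type*} [NormedAddCommGroup V]
    [InnerProductSpace ℝ V] [FiniteDimensional ℝ V] [MeasurableSpace V] [BorelSpace V] {k : ℕ}
    (hk : Module.finrank ℝ V = k + 3) :
    Integrable fun x : V => (‖x‖ ^ 2)⁻¹ * ((1 + ‖x‖) ^ (k + 2))⁻¹ := by
  have : Nontrivial V := Module.nontrivial_of_finrank_pos (R := ℝ) (by omega)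
  rw [integrable_fun_norm_addHaar volume
    (f := fun y : ℝ => (y ^ 2)⁻¹ * ((1 + y) ^ (k + 2))⁻¹), hk]
  refine Integrable.mono' integrable_inv_one_add_sq.integrableOn
    (Measurable.aestronglyMeasurable (by fun_prop)) ?_
  filter_upwards [ae_restrict_mem measurableSet_Ioi] with r hr
  have hr0 : 0 < r := hr
  have hcancel : r ^ (k + 3 - 1) • ((r ^ 2)⁻¹ * ((1 + r) ^ (k + 2))⁻¹) =
      r ^ k * ((1 + r) ^ (k + 2))⁻¹ := by
    rw [Nat.add_sub_assoc (by omega), smul_eq_mul, pow_add]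
    field_simp
  rw [hcancel, Real.norm_of_nonneg (by positivity)]
  exact pow_mul_inv_one_add_pow_le k hr0.le

theorem IsAdmissible.exists_integrable_bpFunction_mul_inv_pow (hK : IsAdmissible K)
    (hn : 2 ≤ n) :
    ∃ N : ℕ, Integrable fun x => bpFunction (K : Set (RSpace n)) x * ((1 + ‖x‖) ^ N)⁻¹ := by
  obtain ⟨C, hle⟩ := hK.exists_bpFunction_le
  have hfinrank : Module.finrank ℝ (RSpace n) = 2 * n - 3 + 3 := by
    rw [finrank_RSpace]
    omega
  have hbp := hK.measurable_bpFunction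
  refine ⟨2 * n - 3 + 2, ((integrable_inv_norm_sq_mul_inv_one_add_norm_pow
    hfinrank).const_mul C).mono' (Measurable.aestronglyMeasurable (by fun_prop))
    (Filter.Eventually.of_forall fun x => ?_)⟩
  have hnonneg := hK.bpFunction_nonneg x
  rw [Real.norm_of_nonneg (by positivity), ← mul_assoc]
  exact mul_le_mul_of_nonneg_right (hle x) (by positivity)

theorem IsAdmissible.exists_represents_bpFunction (hK : IsAdmissible K) (hn : 2 ≤ n) :
    ∃ T : 𝓢'(RSpace n, ℂ), Represents (bpFunction (K : Set (RSpace n))) T :=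
  let ⟨_, hfi⟩ := hK.exists_integrable_bpFunction_mul_inv_pow hn
  exists_represents_of_integrable_mul_inv_pow hK.measurable_bpFunction hK.bpFunction_nonneg hfi

end TemperedDistribution

section TwoDimensionalPositivity

variable {n : ℕ}

theorem integral_complexLine (ψ : 𝓢(RSpace n, ℂ)) {x : RSpace n} (hx : ‖x‖ = 1) :
    ∫ z : ℂ, ψ (complexLine x hx z) =
      ∫ u : Metric.sphere (0 : ℂ) 1, rayIntegral ψ (cmul u x) ∂sphereMeasure ℂ := by
  have hfi : Integrable fun z : ℂ => ψ (complexLine x hx z) := by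
    obtain ⟨C, -, hψ⟩ := exists_norm_le_inv_pow ψ (Module.finrank ℝ ℂ + 1)
    refine (integrable_inv_one_add_norm_pow.const_mul C).mono'
      (ψ.continuous.comp (complexLine x hx).continuous).aestronglyMeasurable
      (Filter.Eventually.of_forall fun z => ?_)
    simpa only [LinearIsometry.norm_map] using hψ (complexLine x hx z)
  have hsmul : ∀ (r : ℝ) (u : ℂ), complexLine x hx (r • u) = r • cmul u x := fun r u =>
    cmul_smul r u x
  rw [integral_eq_integral_toSphere hfi]
  simp only [rayIntegral, hsmul, Complex.finrank_real_complex, Nat.add_one_sub_one, pow_one]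

theorem IsAdmissible.integral_sphere_bpFunction_mul_cmul {K : ConvexBody (RSpace n)}
    (hK : IsAdmissible K) (g : RSpace n → ℂ) {u : ℂ} (hu : ‖u‖ = 1) :
    ∫ θ : Metric.sphere (0 : RSpace n) 1, (bpFunction (K : Set (RSpace n)) θ : ℂ) * g (cmul u θ)
        ∂sphereMeasure (RSpace n) =
      ∫ θ : Metric.sphere (0 : RSpace n) 1, (bpFunction (K : Set (RSpace n)) θ : ℂ) * g θ
        ∂sphereMeasure (RSpace n) := by
  rw [← integral_sphereMap (cmulIsometry u hu)
    fun θ : Metric.sphere (0 : RSpace n) 1 => (bpFunction (K : Set (RSpace n)) θ : ℂ) * g θ]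
  congr 1
  funext θ
  change _ = (bpFunction (K : Set (RSpace n)) (cmul u (θ : RSpace n)) : ℂ) * g (cmul u θ)
  rw [hK.bpFunction_cmul hu]

theorem IsAdmissible.continuous_bpFunction_mul_rayIntegral_cmul {K : ConvexBody (RSpace n)}
    (hK : IsAdmissible K) (ψ : 𝓢(RSpace n, ℂ)) :
    Continuous fun q : Metric.sphere (0 : RSpace n) 1 × Metric.sphere (0 : ℂ) 1 =>
      (bpFunction (K : Set (RSpace n)) q.1 : ℂ) * rayIntegral ψ (cmul q.2 q.1) := by
  have hcmul : Continuous fun q : Metric.sphere (0 : RSpace n) 1 × Metric.sphere (0 : ℂ) 1 =>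
      cmul (q.2 : ℂ) (q.1 : RSpace n) :=
    continuous_cmul.comp (f := fun q : Metric.sphere (0 : RSpace n) 1 × Metric.sphere (0 : ℂ) 1 =>
      ((q.2 : ℂ), (q.1 : RSpace n))) (by fun_prop)
  exact (Complex.continuous_ofReal.comp (hK.continuous_bpFunction_sphere.comp continuous_fst)).mul
    (continuous_rayIntegral ψ hcmul fun q => by simp [norm_cmul])

variable {K : ConvexBody (RSpace 2)}

theorem integral_bpFunction_mul_eq_rayIntegral (ψ : 𝓢(RSpace 2, ℂ))
    (hfi : Integrable fun x => (bpFunction (K : Set (RSpace 2)) x : ℂ) * ψ x) :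
    ∫ x, (bpFunction (K : Set (RSpace 2)) x : ℂ) * ψ x =
      ∫ θ : Metric.sphere (0 : RSpace 2) 1,
        (bpFunction (K : Set (RSpace 2)) θ : ℂ) * rayIntegral ψ θ
        ∂sphereMeasure (RSpace 2) := by
  rw [integral_eq_integral_toSphere hfi, finrank_RSpace]
  congr 1
  funext θ
  unfold rayIntegral
  rw [← integral_const_mul]
  refine setIntegral_congr_fun measurableSet_Ioi fun r hr => ?_
  have hr0 : (r : ℂ) ≠ 0 := Complex.ofReal_ne_zero.2 (Set.mem_Ioi.1 hr).ne'
  rw [bpFunction_smul _ hr, Complex.real_smul, Complex.real_smul]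
  push_cast
  field_simp

-- Homogeneity of degree `-2` leaves the density `r dr` on rays of `ℝ⁴`, which is that of a plane,
-- so averaging over the rotations turns the rays into complex lines.
theorem IsAdmissible.sphereMeasure_smul_integral_bpFunction_mul (hK : IsAdmissible K)
    (ψ : 𝓢(RSpace 2, ℂ))
    (hfi : Integrable fun x => (bpFunction (K : Set (RSpace 2)) x : ℂ) * ψ x) :
    (sphereMeasure ℂ).real Set.univ • ∫ x, (bpFunction (K : Set (RSpace 2)) x : ℂ) * ψ x =
      ∫ θ : Metric.sphere (0 : RSpace 2) 1, (bpFunction (K : Set (RSpace 2)) θ : ℂ) *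
        (∫ z : ℂ, ψ (complexLine (θ : RSpace 2) (by simp) z)) ∂sphereMeasure (RSpace 2) := by
  have hrot : ∀ u : Metric.sphere (0 : ℂ) 1, ‖(u : ℂ)‖ = 1 := fun u => by simp
  simp only [integral_complexLine, ← integral_const_mul]
  rw [integral_integral_swap
    (integrable_of_continuous (hK.continuous_bpFunction_mul_rayIntegral_cmul ψ))]
  simp only [hK.integral_sphere_bpFunction_mul_cmul _ (hrot _), integral_const]
  rw [integral_bpFunction_mul_eq_rayIntegral ψ hfi]

theorem isPositiveDefiniteDistribution_two (hK : IsAdmissible K) :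
    IsPositiveDefiniteDistribution (bpFunction (K : Set (RSpace 2))) := by
  obtain ⟨T, hT⟩ := hK.exists_represents_bpFunction le_rfl
  refine ⟨T, hT, fun φ => ?_⟩
  obtain ⟨hfi, hval⟩ := hT (autoConv φ)
  have hlines := hK.sphereMeasure_smul_integral_bpFunction_mul (autoConv φ) hfi
  choose j hj0 hj using fun θ : Metric.sphere (0 : RSpace 2) 1 =>
    exists_nonneg_integral_autoConv_eq φ (complexLine (θ : RSpace 2) (by simp))
  simp only [hj, ← Complex.ofReal_mul] at hlines
  rw [← hval, integral_complex_ofReal] at hlines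
  have hnonneg : 0 ≤ ∫ θ : Metric.sphere (0 : RSpace 2) 1,
      bpFunction (K : Set (RSpace 2)) θ * j θ ∂sphereMeasure (RSpace 2) :=
    integral_nonneg fun θ => mul_nonneg (hK.bpFunction_nonneg _) (hj0 θ)
  have hpos : 0 < (sphereMeasure ℂ).real Set.univ := sphereMeasure_real_univ_pos
  have hre := congrArg Complex.re hlines
  have him := congrArg Complex.im hlines
  simp only [Complex.smul_re, Complex.smul_im, Complex.ofReal_re, Complex.ofReal_im,
    smul_eq_mul] at hre him
  rw [← hre] at hnonneg
  exact ⟨nonneg_of_mul_nonneg_right hnonneg hpos, (mul_eq_zero.1 him).resolve_left hpos.ne'⟩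

end TwoDimensionalPositivity

theorem busemannPettyAffirmative_iff {n : ℕ} (hn : 2 ≤ n) :
    BusemannPettyAffirmative n ↔ n = 2 := by
  constructor
  · intro h
    by_contra hne
    exact not_busemannPettyAffirmative (by omega) h
  · rintro rfl
    exact busemannPettyAffirmative_two

theorem forall_isPositiveDefiniteDistribution_iff {n : ℕ} (hn : 2 ≤ n) :
    (∀ K : ConvexBody (RSpace n), IsAdmissible K →
      IsPositiveDefiniteDistribution (bpFunction (K : Set (RSpace n)))) ↔ n = 2 := by
  constructor
  · intro h
    by_contra hne
    obtain ⟨K, hK, hnot⟩ := exists_not_isPositiveDefiniteDistribution (n := n) (by omega)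
    exact hnot (h K hK)
  · rintro rfl K hK
    exact isPositiveDefiniteDistribution_two hK

end ComplexHyperbolicBP

end

theorem theorem3 (n : ℕ) (hn : 2 ≤ n) :
    ComplexHyperbolicBP.BusemannPettyAffirmative n ↔
      ∀ K : ConvexBody (ComplexHyperbolicBP.RSpace n), ComplexHyperbolicBP.IsAdmissible K →
        ComplexHyperbolicBP.IsPositiveDefiniteDistribution
          (ComplexHyperbolicBP.bpFunction (K : Set (ComplexHyperbolicBP.RSpace n))) :=
  (ComplexHyperbolicBP.busemannPettyAffirmative_iff hn).trans
    (ComplexHyperbolicBP.forall_isPositiveDefiniteDistribution_iff hn).symm
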